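/- Consider the discrete-time Wiener phase noise channel with $L$ output samples per input symbol, $$Y_k = X_{\lceil k/L\rceil}\,\Delta\, e^{j\Theta_k} + N_k,\qquad \Delta = 1/L,\quad k=1,2,\dots,$$ where $\Theta_1$ is uniform on $[-\pi,\pi)$, $\Theta_{k+1}=\Theta_k+W_k$, the $W_k$ are i.i.d. real Gaussian with mean $0$ and variance $2\pi\beta\Delta$ ($\beta>0$), the $N_k$ are i.i.d. circularly-symmetric complex Gaussian with mean $0$ and $\mathbb{E}|N_k|^2=\sigma_N^2\Delta$ ($\sigma_N^2>0$), and the input process $\{X_k\}$, $\Theta_1$, $\{W_k\}$ and $\{N_k\}$ are independent. Let $P>0$, $\mathsf{SNR}=P/\sigma_N^2$ and $L=\lceil\beta\sqrt{\mathsf{SNR}}\rceil$. Suppose that the amplitudes $X_{A,k}=|X_k|$ are i.i.d. and that $|X_k|^2$ has the shifted exponential density $$p_{X_P}(u)=\begin{cases}\frac{2}{P}\exp\left(1-\frac{2u}{P}\right), & u\ge P/2,\\ 0,&\text{otherwise,}\end{cases}$$ with no further restriction on the joint law of the phases of the $X_k$. Write $\boldsymbol{Y}^n=(Y_1,\dots,Y_{nL})$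 and $$I(X_A;\boldsymbol{Y})=\lim_{n\to\infty}\frac1n I(X_A^n;\boldsymbol{Y}^n)\quad\text{(in nats)},$$ read as a lower limit if the limit does not exist. If the complex symbols $X_k$ are i.i.d. (with any dependence between phase and amplitude of a symbol), this limit exists and is finite. In every case, with $\beta$ fixed and $\log$ the natural logarithm, $$\liminf_{\mathsf{SNR}\to\infty}\left[I(X_A;\boldsymbol{Y})-\tfrac12\log\mathsf{SNR}\right]\ \ge\ -2-\tfrac12\log(8\pi).$$ Here the joint law of the phases and the noise variance $\sigma_N^2$ may vary with $\mathsf{SNR}$ (with $P=\mathsf{SNR}\,\sigma_N^2$). -/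

import Mathlib

open MeasureTheory ProbabilityTheory Filter Topology
open scoped ENNReal

namespace WienerPhaseNoise

noncomputable section

/-- Mutual information `I(U;V)` in nats of two random variables on `(Ω, μ)`: the Kullback-Leibler
divergence of the joint law from the product of the marginal laws. -/
def mutualInfo {Ω α γ : Type*} [MeasurableSpace Ω] [MeasurableSpace α] [MeasurableSpace γ]
    (μ : Measure Ω) (U : Ω → α) (V : Ω → γ) : ℝ≥0∞ :=
  InformationTheory.klDiv (μ.map fun ω => (U ω, V ω)) ((μ.map U).prod (μ.map V))

/-- Circularly-symmetric complex Gaussian law with mean `0` and `E|N|^2 = v` (for `0 ≤ v`):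
independent real and imaginary parts, each of variance `v / 2`. -/
def complexGaussian (v : ℝ) : Measure ℂ :=
  ((gaussianReal 0 (v / 2).toNNReal).prod (gaussianReal 0 (v / 2).toNNReal)).map
    Complex.measurableEquivRealProd.symm

instance (v : ℝ) : IsProbabilityMeasure (complexGaussian v) :=
  Measure.isProbabilityMeasure_map Complex.measurableEquivRealProd.symm.measurable.aemeasurable

/-- The uniform law on `[-π, π)`. -/
def uniformPhase : Measure ℝ :=
  ProbabilityTheory.cond (volume : Measure ℝ) (Set.Ico (-Real.pi) Real.pi)

instance : IsProbabilityMeasure uniformPhase := by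
  refine cond_isProbabilityMeasure_of_finite ?_ ?_
  · simp [Real.volume_Ico, Real.pi_pos]
  · simp [Real.volume_Ico]

/-- The law on `ℝ` with density `(2 / P) exp (1 - 2 u / P)` for `u ≥ P / 2`, and `0` otherwise. -/
def shiftedExp (P : ℝ) : Measure ℝ :=
  (volume : Measure ℝ).withDensity fun u =>
    ENNReal.ofReal (if P / 2 ≤ u then 2 / P * Real.exp (1 - 2 * u / P) else 0)

/-- The sample space of the channel. A point `(x, θ, w, z)` consists of the input symbols `x`, the
initial phase `θ`, the phase increments `w` and the additive noise samples `z`.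
All sequences are indexed from `0`. -/
abbrev Sample : Type := (ℕ → ℂ) × ℝ × (ℕ → ℝ) × (ℕ → ℂ)

/-- The law of the channel when the input process has law `input` and there are `L` samples per
symbol (so `Δ = 1 / L`): the input, the initial phase (uniform on `[-π, π)`), the increments
(i.i.d. real Gaussian of variance `2 π β Δ`) and the noise (i.i.d. circularly-symmetric complex
Gaussian of variance `σN2 Δ`) are independent. -/
def channelLaw (β σN2 : ℝ) (L : ℕ) (input : Measure (ℕ → ℂ)) : Measure Sample :=
  input.prod (uniformPhase.prod
    ((Measure.infinitePi fun _ : ℕ => gaussianReal 0 (2 * Real.pi * β * (1 / L)).toNNReal).prod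
      (Measure.infinitePi fun _ : ℕ => complexGaussian (σN2 * (1 / L)))))

/-- The Wiener phase noise: `Θ` at index `0` is the initial phase and `Θ_{k+1} = Θ_k + W_k`. -/
def phase (ω : Sample) : ℕ → ℝ
  | 0 => ω.2.1
  | k + 1 => phase ω k + ω.2.2.1 k

/-- The output sample of index `k`: the input symbol of index `⌊k / L⌋` times `Δ e^{jΘ_k}`,
plus noise. -/
def output (L : ℕ) (ω : Sample) (k : ℕ) : ℂ :=
  ω.1 (k / L) * ((1 / L : ℝ) : ℂ) * Complex.exp (Complex.I * (phase ω k : ℂ)) + ω.2.2.2 k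

/-- `I(X_A^n ; Y^n)`: the mutual information between the amplitudes of the first `n` input symbols
and the corresponding `n L` output samples. -/
def amplitudeInfo (β σN2 : ℝ) (L : ℕ) (input : Measure (ℕ → ℂ)) (n : ℕ) : ℝ≥0∞ :=
  mutualInfo (channelLaw β σN2 L input)
    (fun ω => fun k : Fin n => ‖ω.1 k‖)
    (fun ω => fun i : Fin (n * L) => output L ω i)

/-- The information rate `I(X_A ; Y)`, the limit of `I(X_A^n ; Y^n) / n`; where that limit is not
known to exist, the lower limit. -/
def amplitudeRate (β σN2 : ℝ) (L : ℕ) (input : Measure (ℕ → ℂ)) : ℝ≥0∞ :=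
  liminf (fun n : ℕ => amplitudeInfo β σN2 L input n / n) atTop

/-- The amplitudes `|X_k|` are i.i.d. and `|X_k|^2` has the law `shiftedExp P`. -/
def HasShiftedExpAmplitudes (P : ℝ) (input : Measure (ℕ → ℂ)) : Prop :=
  iIndepFun (fun (k : ℕ) (x : ℕ → ℂ) => ‖x k‖) input ∧
    ∀ k : ℕ, input.map (fun x => ‖x k‖ ^ 2) = shiftedExp P

/-- The complex input symbols `X_k` are i.i.d. -/
def IsIID (input : Measure (ℕ → ℂ)) : Prop :=
  iIndepFun (fun (k : ℕ) (x : ℕ → ℂ) => x k) input ∧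
    ∀ k : ℕ, input.map (fun x => x k) = input.map (fun x => x 0)

/-- The oversampling factor `L = ⌈β √SNR⌉`. -/
def samplesPerSymbol (β snr : ℝ) : ℕ := ⌈β * √snr⌉₊

end

end WienerPhaseNoise

/-!
Two ideas carry the proof.

**Lower bounds on mutual information come from a test function.** By the Donsker-Varadhan inequality
`ofReal_integral_log_le_klDiv`, every nonnegative `g (x, y)` whose integral against the product of
the marginal laws is at most `1` gives `I(U; V) ≥ E log g (U, V)`. If `g` is a product over blocks
of functions that integrate to at most `1` over the input for each fixed output, and the inputs are
independent, then `g` is admissible however dependent the output blocks are. This disposes of the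
memory of the phase process, and is used twice.

* For the asymptotic bound, use the energy `∑ |Y_k|²` of a block: given the input and the phases,
  its mean and its variance depend on `|X|` only. With `s = |X|² / σ²` and the normalized, recentred
  energy `t`, take as test function the ratio `(snr / 2) N(t; s, c)` of a Gaussian density to an
  upper bound on its output density; the bound holds because `s` has a density at most `2 / snr`.
  Given the input and the phases, `t - s` is a sum of centred independent terms and its mean square
  is at most `8 s + O(L)`. On average this is `8 snr + O(L)`, so that `c = 16 snr` is enough when
  `L = O(√snr)`. Per symbol this leaves `log (snr / 2) - log (32 π snr) / 2 - 1 / 2`, which is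
  `log snr / 2 - log (8 π) / 2 - 2 log 2 - 1 / 2`, and `2 log 2 < 3 / 2`
  (`ofReal_le_amplitudeInfo`, `auxiliary_channel_bound_ge`).

* For an i.i.d. input, the product of the likelihood ratios of two consecutive blocks shows that the
  information of `n + m` symbols is at least that of the first `n` plus that of the last `m`
  (`mutualInfo_add_le`).

**The limit exists by Fekete's lemma.** The information of the last `m` symbols is that of the first
`m`, because the channel is stationary once the phase is reduced modulo `2π`: the time shift rotates
the initial phase, whose law on the circle is invariant (`measurePreserving_blockShift`). Hence the
information is superadditive. It grows at most linearly (`exists_amplitudeInfo_le`): the conditional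
density of the output is at most the supremum of the noise density, while by Jensen's inequality the
density of the output is at least that supremum times `e ^ (-h)`, with `h` quadratic, so that the
likelihood ratio is at most `e ^ h` and the divergence at most `E h + 1`.
-/

namespace WienerPhaseNoise

open InformationTheory

/-! ### Bounds on the Kullback-Leibler divergence -/

section Divergence

variable {α : Type*} [MeasurableSpace α] {μ ν : Measure α}
  [IsProbabilityMeasure μ] [IsProbabilityMeasure ν]

/-- Donsker-Varadhan lower bound for the divergence, for a test function `log g` normalized by
`∫ g dν ≤ 1`. It is stated for `g` rather than for `log g` so that `g` may vanish on a `μ`-null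
set, as likelihood ratios do. -/
lemma ofReal_integral_log_le_klDiv {g : α → ℝ≥0∞} (hg : Measurable g) (hgν : ∫⁻ a, g a ∂ν ≤ 1)
    (hpos : ∀ᵐ a ∂μ, g a ≠ 0) (hint : Integrable (fun a => Real.log (g a).toReal) μ) :
    ENNReal.ofReal (∫ a, Real.log (g a).toReal ∂μ) ≤ klDiv μ ν := by
  by_cases hfin : klDiv μ ν = ∞
  · simp [hfin]
  obtain ⟨hac, hllr⟩ := klDiv_ne_top_iff.1 hfin
  refine ENNReal.ofReal_le_of_le_toReal ?_
  rw [toReal_klDiv_of_measure_eq hac (by simp)]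
  have hle : ∫⁻ a, g a / μ.rnDeriv ν a ∂μ ≤ 1 := by
    rw [← lintegral_rnDeriv_mul hac (by fun_prop)]
    exact (lintegral_mono fun a => ENNReal.mul_div_le).trans hgν
  have hm : AEMeasurable (fun a => g a / μ.rnDeriv ν a) μ := by fun_prop
  have hne : ∫⁻ a, g a / μ.rnDeriv ν a ∂μ ≠ ∞ := ne_top_of_le_ne_top ENNReal.one_ne_top hle
  have hquot : Integrable (fun a => (g a / μ.rnDeriv ν a).toReal) μ :=
    integrable_toReal_of_lintegral_ne_top hm hne
  have hquot_le : ∫ a, (g a / μ.rnDeriv ν a).toReal ∂μ ≤ 1 := by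
    rw [integral_toReal hm (ae_lt_top' hm hne)]
    exact ENNReal.toReal_le_of_le_ofReal zero_le_one (by simpa using hle)
  have hg_top : ∀ᵐ a ∂μ, g a < ∞ :=
    hac.ae_le (ae_lt_top hg (ne_top_of_le_ne_top ENNReal.one_ne_top hgν))
  have key : ∀ᵐ a ∂μ, Real.log (g a).toReal - llr μ ν a ≤ (g a / μ.rnDeriv ν a).toReal - 1 := by
    filter_upwards [hpos, hg_top, Measure.rnDeriv_pos hac, hac.ae_le (Measure.rnDeriv_lt_top μ ν)]
      with a h0 h1 h2 h3
    have hgp := ENNReal.toReal_pos h0 h1.ne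
    have hrp := ENNReal.toReal_pos h2.ne' h3.ne
    rw [llr, ← Real.log_div hgp.ne' hrp.ne', ENNReal.toReal_div]
    exact Real.log_le_sub_one_of_pos (div_pos hgp hrp)
  have := integral_mono_ae (hint.sub hllr) (hquot.sub (integrable_const 1)) key
  simp only [Pi.sub_apply] at this
  rw [integral_sub hint hllr, integral_sub hquot (integrable_const 1)] at this
  rw [integral_const, probReal_univ, one_smul] at this
  linarith

/-- If `μ` is dominated by `e ^ h ν`, then the divergence is at most `∫ h dμ + 1`. -/
lemma klDiv_le_of_le_withDensity {h : α → ℝ} (hm : Measurable h) (h0 : ∀ a, 0 ≤ h a)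
    (hle : μ ≤ ν.withDensity fun a => ENNReal.ofReal (Real.exp (h a))) :
    klDiv μ ν ≤ ∫⁻ a, ENNReal.ofReal (h a) ∂μ + 1 := by
  have hac : μ ≪ ν :=
    (Measure.absolutelyContinuous_of_le hle).trans (withDensity_absolutelyContinuous _ _)
  have hr : μ.rnDeriv ν ≤ᵐ[ν] fun a => ENNReal.ofReal (Real.exp (h a)) := by
    refine ae_le_of_forall_setLIntegral_le_of_sigmaFinite (Measure.measurable_rnDeriv μ ν) ?_
    intro s hs _
    rw [Measure.setLIntegral_rnDeriv hac, ← withDensity_apply _ hs]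
    exact hle s
  rw [klDiv_eq_lintegral_klFun_of_ac hac, ← lintegral_rnDeriv_mul hac (by fun_prop)]
  calc ∫⁻ a, ENNReal.ofReal (klFun (μ.rnDeriv ν a).toReal) ∂ν
      ≤ ∫⁻ a, (μ.rnDeriv ν a * ENNReal.ofReal (h a) + 1) ∂ν := by
        refine lintegral_mono_ae ?_
        filter_upwards [hr] with a ha
        have htop : μ.rnDeriv ν a ≠ ∞ := ne_top_of_le_ne_top ENNReal.ofReal_ne_top ha
        have hr' : (μ.rnDeriv ν a).toReal ≤ Real.exp (h a) :=
          ENNReal.toReal_le_of_le_ofReal (Real.exp_pos _).le ha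
        rw [← ENNReal.ofReal_toReal htop, ENNReal.toReal_ofReal ENNReal.toReal_nonneg,
          ← ENNReal.ofReal_mul ENNReal.toReal_nonneg, ← ENNReal.ofReal_one,
          ← ENNReal.ofReal_add (mul_nonneg ENNReal.toReal_nonneg (h0 a)) zero_le_one]
        refine ENNReal.ofReal_le_ofReal ?_
        rw [klFun_apply]
        rcases (ENNReal.toReal_nonneg (a := μ.rnDeriv ν a)).eq_or_lt with h | h
        · simp [← h]
        · have : Real.log (μ.rnDeriv ν a).toReal ≤ _ := (Real.log_le_iff_le_exp h).2 hr'
          nlinarith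
    _ = _ := by
        rw [lintegral_add_right _ measurable_const]
        simp

end Divergence

/-! ### Superadditivity of mutual information -/

section MutualInformation

/-- The conditional densities of a joint law are normalized: integrating the density of `ρ` with
respect to `P × ρ.snd` over the first variable gives `1`. -/
lemma lintegral_rnDeriv_prod_snd {α γ : Type*} [MeasurableSpace α] [MeasurableSpace γ]
    {ρ : Measure (α × γ)} {P : Measure α} {Q : Measure γ} [IsProbabilityMeasure ρ]
    [IsProbabilityMeasure P] [IsProbabilityMeasure Q] (hQ : ρ.map Prod.snd = Q)
    (hac : ρ ≪ P.prod Q) :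
    ∀ᵐ c ∂Q, ∫⁻ a, ρ.rnDeriv (P.prod Q) (a, c) ∂P = 1 := by
  refine ae_eq_of_forall_setLIntegral_eq_of_sigmaFinite ?_ measurable_const ?_
  · exact (Measure.measurable_rnDeriv ρ (P.prod Q)).lintegral_prod_left'
  intro s hs _
  calc ∫⁻ c in s, ∫⁻ a, ρ.rnDeriv (P.prod Q) (a, c) ∂P ∂Q
      = ∫⁻ z in Set.univ ×ˢ s, ρ.rnDeriv (P.prod Q) z ∂(P.prod Q) := by
        rw [← Measure.prod_restrict, Measure.restrict_univ,
          lintegral_prod_symm' _ (Measure.measurable_rnDeriv ρ (P.prod Q))]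
    _ = ρ (Set.univ ×ˢ s) := Measure.setLIntegral_rnDeriv hac _
    _ = Q s := by
        rw [← hQ, Measure.map_apply measurable_snd hs, Set.univ_prod]
    _ = ∫⁻ _ in s, 1 ∂Q := by simp

variable {Ω α γ α₁ α₂ γ₁ γ₂ : Type*} [MeasurableSpace Ω] [MeasurableSpace α] [MeasurableSpace γ]
  [MeasurableSpace α₁] [MeasurableSpace α₂] [MeasurableSpace γ₁] [MeasurableSpace γ₂]
  {μ : Measure Ω} [IsProbabilityMeasure μ] {U : Ω → α} {V : Ω → γ}

/-- Mutual information is superadditive over independent inputs. The test function is the product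
of the two likelihood ratios; for each fixed output it has integral `1` over the inputs, by
independence, whatever the dependence between the two outputs. -/
lemma mutualInfo_add_le (hU : Measurable U) (hV : Measurable V) {p₁ : α → α₁} {p₂ : α → α₂}
    {s₁ : γ → γ₁} {s₂ : γ → γ₂} (hp₁ : Measurable p₁) (hp₂ : Measurable p₂)
    (hs₁ : Measurable s₁) (hs₂ : Measurable s₂)
    (hind : IndepFun (fun ω => p₁ (U ω)) (fun ω => p₂ (U ω)) μ)
    (h₁ : mutualInfo μ (fun ω => p₁ (U ω)) (fun ω => s₁ (V ω)) ≠ ∞)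
    (h₂ : mutualInfo μ (fun ω => p₂ (U ω)) (fun ω => s₂ (V ω)) ≠ ∞) :
    mutualInfo μ (fun ω => p₁ (U ω)) (fun ω => s₁ (V ω)) +
      mutualInfo μ (fun ω => p₂ (U ω)) (fun ω => s₂ (V ω)) ≤ mutualInfo μ U V := by
  unfold mutualInfo at *
  have hU₁ : Measurable fun ω => p₁ (U ω) := hp₁.comp hU
  have hU₂ : Measurable fun ω => p₂ (U ω) := hp₂.comp hU
  have hV₁ : Measurable fun ω => s₁ (V ω) := hs₁.comp hV
  have hV₂ : Measurable fun ω => s₂ (V ω) := hs₂.comp hV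
  have : IsProbabilityMeasure (μ.map U) := Measure.isProbabilityMeasure_map hU.aemeasurable
  have : IsProbabilityMeasure (μ.map V) := Measure.isProbabilityMeasure_map hV.aemeasurable
  have := Measure.isProbabilityMeasure_map (μ := μ) hU₁.aemeasurable
  have := Measure.isProbabilityMeasure_map (μ := μ) hU₂.aemeasurable
  have := Measure.isProbabilityMeasure_map (μ := μ) hV₁.aemeasurable
  have := Measure.isProbabilityMeasure_map (μ := μ) hV₂.aemeasurable
  have := Measure.isProbabilityMeasure_map (μ := μ) (hU.prodMk hV).aemeasurable
  have := Measure.isProbabilityMeasure_map (μ := μ) (hU₁.prodMk hV₁).aemeasurable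
  have := Measure.isProbabilityMeasure_map (μ := μ) (hU₂.prodMk hV₂).aemeasurable
  obtain ⟨hac₁, hl₁⟩ := klDiv_ne_top_iff.1 h₁
  obtain ⟨hac₂, hl₂⟩ := klDiv_ne_top_iff.1 h₂
  have hk₁ := toReal_klDiv_of_measure_eq hac₁ (by simp)
  have hk₂ := toReal_klDiv_of_measure_eq hac₂ (by simp)
  set ρ₁ := μ.map fun ω => (p₁ (U ω), s₁ (V ω))
  set ρ₂ := μ.map fun ω => (p₂ (U ω), s₂ (V ω))
  set π₁ := (μ.map fun ω => p₁ (U ω)).prod (μ.map fun ω => s₁ (V ω))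
  set π₂ := (μ.map fun ω => p₂ (U ω)).prod (μ.map fun ω => s₂ (V ω))
  have hr₁ : Measurable (ρ₁.rnDeriv π₁) := Measure.measurable_rnDeriv _ _
  have hr₂ : Measurable (ρ₂.rnDeriv π₂) := Measure.measurable_rnDeriv _ _
  let g : α × γ → ℝ≥0∞ := fun z =>
    ρ₁.rnDeriv π₁ (p₁ z.1, s₁ z.2) * ρ₂.rnDeriv π₂ (p₂ z.1, s₂ z.2)
  have hgm : Measurable g := by fun_prop
  have hgν : ∫⁻ z, g z ∂(μ.map U).prod (μ.map V) ≤ 1 := by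
    have e₁ := lintegral_rnDeriv_prod_snd (ρ := ρ₁) (P := μ.map fun ω => p₁ (U ω))
      (Q := μ.map fun ω => s₁ (V ω))
      (by rw [Measure.map_map measurable_snd (hU₁.prodMk hV₁)]; rfl) hac₁
    have e₂ := lintegral_rnDeriv_prod_snd (ρ := ρ₂) (P := μ.map fun ω => p₂ (U ω))
      (Q := μ.map fun ω => s₂ (V ω))
      (by rw [Measure.map_map measurable_snd (hU₂.prodMk hV₂)]; rfl) hac₂
    have e₁' := ae_of_ae_map hV₁.aemeasurable e₁
    have e₂' := ae_of_ae_map hV₂.aemeasurable e₂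
    rw [lintegral_prod_symm' _ hgm, lintegral_map (hgm.lintegral_prod_left') hV]
    refine le_of_eq ?_
    calc ∫⁻ ω, ∫⁻ a, g (a, V ω) ∂(μ.map U) ∂μ = ∫⁻ _, 1 ∂μ := by
          refine lintegral_congr_ae ?_
          filter_upwards [e₁', e₂'] with ω h1 h2
          rw [lintegral_map (by fun_prop) hU]
          rw [lintegral_map (by fun_prop) hU₁] at h1
          rw [lintegral_map (by fun_prop) hU₂] at h2
          have := lintegral_mul_eq_lintegral_mul_lintegral_of_indepFun
            (μ := μ) (f := fun ω' => ρ₁.rnDeriv π₁ (p₁ (U ω'), s₁ (V ω)))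
            (g := fun ω' => ρ₂.rnDeriv π₂ (p₂ (U ω'), s₂ (V ω))) (by fun_prop) (by fun_prop)
            (hind.comp (φ := fun x => ρ₁.rnDeriv π₁ (x, s₁ (V ω)))
              (ψ := fun x => ρ₂.rnDeriv π₂ (x, s₂ (V ω))) (by fun_prop) (by fun_prop))
          rw [h1, h2] at this
          simpa using this
      _ = 1 := by simp
  have a₁ : ∀ᵐ ω ∂μ, ρ₁.rnDeriv π₁ (p₁ (U ω), s₁ (V ω)) ≠ 0 :=
    ae_of_ae_map (hU₁.prodMk hV₁).aemeasurable
      ((Measure.rnDeriv_pos hac₁).mono fun _ h => h.ne')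
  have a₂ : ∀ᵐ ω ∂μ, ρ₂.rnDeriv π₂ (p₂ (U ω), s₂ (V ω)) ≠ 0 :=
    ae_of_ae_map (hU₂.prodMk hV₂).aemeasurable
      ((Measure.rnDeriv_pos hac₂).mono fun _ h => h.ne')
  have b₁ : ∀ᵐ ω ∂μ, ρ₁.rnDeriv π₁ (p₁ (U ω), s₁ (V ω)) < ∞ :=
    ae_of_ae_map (hU₁.prodMk hV₁).aemeasurable (hac₁.ae_le (Measure.rnDeriv_lt_top _ _))
  have b₂ : ∀ᵐ ω ∂μ, ρ₂.rnDeriv π₂ (p₂ (U ω), s₂ (V ω)) < ∞ :=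
    ae_of_ae_map (hU₂.prodMk hV₂).aemeasurable (hac₂.ae_le (Measure.rnDeriv_lt_top _ _))
  have hUV := hU.prodMk hV
  have hlog : (fun ω => Real.log (g (U ω, V ω)).toReal) =ᵐ[μ] fun ω =>
      llr ρ₁ π₁ (p₁ (U ω), s₁ (V ω)) + llr ρ₂ π₂ (p₂ (U ω), s₂ (V ω)) := by
    filter_upwards [a₁, a₂, b₁, b₂] with ω h1 h2 h3 h4
    simp only [g, llr, ENNReal.toReal_mul]
    exact Real.log_mul (ENNReal.toReal_pos h1 h3.ne).ne' (ENNReal.toReal_pos h2 h4.ne).ne'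
  have i₁ : Integrable (fun ω => llr ρ₁ π₁ (p₁ (U ω), s₁ (V ω))) μ :=
    hl₁.comp_measurable (hU₁.prodMk hV₁)
  have i₂ : Integrable (fun ω => llr ρ₂ π₂ (p₂ (U ω), s₂ (V ω))) μ :=
    hl₂.comp_measurable (hU₂.prodMk hV₂)
  have hlm : Measurable fun z => Real.log (g z).toReal := by fun_prop
  have main := ofReal_integral_log_le_klDiv (μ := μ.map fun ω => (U ω, V ω)) hgm hgν
    ((ae_map_iff hUV.aemeasurable (by measurability)).2 (by
      filter_upwards [a₁, a₂] with ω h1 h2 using mul_ne_zero h1 h2))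
    ((integrable_map_measure hlm.aestronglyMeasurable hUV.aemeasurable).2
      ((i₁.add i₂).congr hlog.symm))
  rw [integral_map hUV.aemeasurable hlm.aestronglyMeasurable, integral_congr_ae hlog,
    integral_add i₁ i₂] at main
  rw [integral_map (hU₁.prodMk hV₁).aemeasurable (stronglyMeasurable_llr _ _).aestronglyMeasurable]
    at hk₁
  rw [integral_map (hU₂.prodMk hV₂).aemeasurable (stronglyMeasurable_llr _ _).aestronglyMeasurable]
    at hk₂
  rw [← hk₁, ← hk₂, ENNReal.ofReal_add ENNReal.toReal_nonneg ENNReal.toReal_nonneg,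
    ENNReal.ofReal_toReal h₁, ENNReal.ofReal_toReal h₂] at main
  exact main

end MutualInformation

/-! ### Transport along measure-preserving maps -/

section MeasurePreserving

variable {Ω Ω' : Type*} [MeasurableSpace Ω] [MeasurableSpace Ω'] {μ : Measure Ω} {ν : Measure Ω'}
  {f : Ω → Ω'}

lemma mutualInfo_comp_measurePreserving {α γ : Type*} [MeasurableSpace α] [MeasurableSpace γ]
    (hf : MeasurePreserving f μ ν) {U : Ω' → α} {V : Ω' → γ} (hU : Measurable U)
    (hV : Measurable V) :
    mutualInfo μ (fun ω => U (f ω)) (fun ω => V (f ω)) = mutualInfo ν U V := by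
  unfold mutualInfo
  rw [← hf.map_eq, Measure.map_map (hU.prodMk hV) hf.measurable, Measure.map_map hU hf.measurable,
    Measure.map_map hV hf.measurable]
  rfl

lemma iIndepFun_comp_measurePreserving {ι : Type*} {β : ι → Type*} [∀ i, MeasurableSpace (β i)]
    [IsProbabilityMeasure μ] [IsProbabilityMeasure ν] (hf : MeasurePreserving f μ ν)
    {X : ∀ i, Ω' → β i} (hX : ∀ i, Measurable (X i)) (h : iIndepFun X ν) :
    iIndepFun (fun i ω => X i (f ω)) μ := by
  rw [iIndepFun_iff_map_fun_eq_infinitePi_map (X := fun i ω => X i (f ω))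
    fun i => (hX i).comp hf.measurable]
  rw [iIndepFun_iff_map_fun_eq_infinitePi_map hX, ← hf.map_eq,
    Measure.map_map (measurable_pi_iff.2 hX) hf.measurable] at h
  simpa only [Measure.map_map (hX _) hf.measurable, Function.comp_def] using h

lemma measurePreserving_shift {β : Type*} [MeasurableSpace β] (ρ : Measure β)
    [IsProbabilityMeasure ρ] (N : ℕ) :
    MeasurePreserving (fun (w : ℕ → β) i => w (N + i)) (Measure.infinitePi fun _ : ℕ => ρ)
      (Measure.infinitePi fun _ : ℕ => ρ) :=
  ⟨by fun_prop, Measure.map_infinitePi_infinitePi_of_inj (add_right_injective N)⟩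

end MeasurePreserving

/-! ### Stationarity of the channel -/

section Channel

instance (β σN2 : ℝ) (L : ℕ) (input : Measure (ℕ → ℂ)) [IsProbabilityMeasure input] :
    IsProbabilityMeasure (channelLaw β σN2 L input) := by
  unfold channelLaw
  infer_instance

lemma phase_eq_add_sum (ω : Sample) (k : ℕ) :
    phase ω k = ω.2.1 + ∑ i ∈ Finset.range k, ω.2.2.1 i := by
  induction k with
  | zero => simp [phase]
  | succ k ih => rw [phase, ih, Finset.sum_range_succ, add_assoc]

lemma measurable_phase (k : ℕ) : Measurable fun ω => phase ω k := by
  simp only [phase_eq_add_sum]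
  fun_prop

lemma measurable_output (L k : ℕ) : Measurable fun ω => output L ω k := by
  have := measurable_phase k
  unfold output
  fun_prop

lemma measurePreserving_channelLaw_input (β σN2 : ℝ) (L : ℕ) (input : Measure (ℕ → ℂ))
    [IsProbabilityMeasure input] :
    MeasurePreserving (Prod.fst : Sample → ℕ → ℂ) (channelLaw β σN2 L input) input :=
  measurePreserving_fst

/-- A positive period, as required for the measure structure of `AddCircle (2 * π)`. -/
instance fact_two_pi_pos : Fact (0 < 2 * Real.pi) := ⟨Real.two_pi_pos⟩

/-- The uniform law on the circle `ℝ / 2πℤ`. -/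
noncomputable def uniformAngle : Measure (AddCircle (2 * Real.pi)) :=
  uniformPhase.map (fun θ : ℝ => (θ : AddCircle (2 * Real.pi)))

lemma measurable_angle_mk : Measurable (fun θ : ℝ => (θ : AddCircle (2 * Real.pi))) :=
  (AddCircle.continuous_mk' _).measurable

instance : IsProbabilityMeasure uniformAngle :=
  Measure.isProbabilityMeasure_map measurable_angle_mk.aemeasurable

lemma uniformAngle_eq_smul :
    uniformAngle = (volume (Set.Ico (-Real.pi) Real.pi))⁻¹ •
      (volume : Measure (AddCircle (2 * Real.pi))) := by
  have h := (AddCircle.measurePreserving_mk (2 * Real.pi) (-Real.pi)).map_eq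
  rw [show -Real.pi + 2 * Real.pi = Real.pi by ring, Measure.restrict_congr_set Ico_ae_eq_Ioc.symm]
    at h
  rw [uniformAngle, uniformPhase, ProbabilityTheory.cond, Measure.map_smul, h]

lemma map_add_right_uniformAngle (a : AddCircle (2 * Real.pi)) :
    uniformAngle.map (fun φ => φ + a) = uniformAngle := by
  rw [uniformAngle_eq_smul, Measure.map_smul, map_add_right_eq_self]

/-- The sample space with the initial phase reduced modulo `2π`. -/
abbrev ReducedSample : Type := (ℕ → ℂ) × AddCircle (2 * Real.pi) × (ℕ → ℝ) × (ℕ → ℂ)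

/-- Reduction of the initial phase modulo `2π`. -/
noncomputable def reducePhase (ω : Sample) : ReducedSample :=
  (ω.1, (ω.2.1 : AddCircle (2 * Real.pi)), ω.2.2)

/-- The law of the channel with the initial phase reduced modulo `2π`. -/
noncomputable def reducedLaw (β σN2 : ℝ) (L : ℕ) (input : Measure (ℕ → ℂ)) :
    Measure ReducedSample :=
  input.prod (uniformAngle.prod
    ((Measure.infinitePi fun _ : ℕ => gaussianReal 0 (2 * Real.pi * β * (1 / L)).toNNReal).prod
      (Measure.infinitePi fun _ : ℕ => complexGaussian (σN2 * (1 / L)))))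

/-- The output sample of index `k` as a function of the reduced sample point. -/
noncomputable def reducedOutput (L : ℕ) (q : ReducedSample) (k : ℕ) : ℂ :=
  q.1 (k / L) * ((1 / L : ℝ) : ℂ) *
    (AddCircle.toCircle (q.2.1 + ((∑ i ∈ Finset.range k, q.2.2.1 i : ℝ) :
      AddCircle (2 * Real.pi))) : ℂ) + q.2.2.2 k

/-- The time shift by `n` symbols, that is by `n * L` output samples. -/
noncomputable def blockShift (L n : ℕ) (q : ReducedSample) : ReducedSample :=
  (fun k => q.1 (n + k),
    q.2.1 + ((∑ i ∈ Finset.range (n * L), q.2.2.1 i : ℝ) : AddCircle (2 * Real.pi)),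
    fun k => q.2.2.1 (n * L + k), fun k => q.2.2.2 (n * L + k))

lemma measurable_reducedOutput (L k : ℕ) : Measurable fun q => reducedOutput L q k := by
  have h3 : Measurable fun φ : AddCircle (2 * Real.pi) => (AddCircle.toCircle φ : ℂ) :=
    (continuous_subtype_val.comp AddCircle.continuous_toCircle).measurable
  unfold reducedOutput
  have h4 : Measurable fun q : ReducedSample =>
      q.2.1 + ((∑ i ∈ Finset.range k, q.2.2.1 i : ℝ) : AddCircle (2 * Real.pi)) :=
    (by fun_prop : Measurable fun q : ReducedSample => q.2.1).add
      (measurable_angle_mk.comp (by fun_prop : Measurable fun q : ReducedSample =>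
        ∑ i ∈ Finset.range k, q.2.2.1 i))
  have h5 := h3.comp h4
  simp only [Function.comp_def] at h5
  fun_prop

lemma reducedOutput_reducePhase (L : ℕ) (ω : Sample) (k : ℕ) :
    reducedOutput L (reducePhase ω) k = output L ω k := by
  simp only [reducedOutput, reducePhase, output, phase_eq_add_sum, ← AddCircle.coe_add,
    AddCircle.toCircle_apply_mk, Circle.coe_exp]
  rw [div_self Real.two_pi_pos.ne', one_mul, mul_comm Complex.I]

lemma reducedOutput_blockShift {L : ℕ} (hL : 0 < L) (n : ℕ) (q : ReducedSample) (k : ℕ) :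
    reducedOutput L (blockShift L n q) k = reducedOutput L q (n * L + k) := by
  simp only [reducedOutput, blockShift, add_assoc, ← AddCircle.coe_add,
    ← Finset.sum_range_add]
  rw [mul_comm n L, Nat.mul_add_div hL]

lemma measurePreserving_reducePhase (β σN2 : ℝ) (L : ℕ) (input : Measure (ℕ → ℂ))
    [IsProbabilityMeasure input] :
    MeasurePreserving reducePhase (channelLaw β σN2 L input) (reducedLaw β σN2 L input) :=
  (MeasurePreserving.id input).prod
    (MeasurePreserving.prod ⟨measurable_angle_mk, rfl⟩ (MeasurePreserving.id _))

lemma IsIID.measurePreserving_shift {input : Measure (ℕ → ℂ)} [IsProbabilityMeasure input]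
    (h : IsIID input) (n : ℕ) :
    MeasurePreserving (fun (x : ℕ → ℂ) k => x (n + k)) input input := by
  have h1 := (iIndepFun_iff_map_fun_eq_infinitePi_map (by fun_prop)).1 h.1
  simp only [h.2] at h1
  have hid : input = Measure.infinitePi fun _ : ℕ => input.map fun x => x 0 := by
    rw [← h1]
    exact Measure.map_id.symm
  have : IsProbabilityMeasure (input.map fun x => x 0) :=
    Measure.isProbabilityMeasure_map (measurable_pi_apply 0).aemeasurable
  have h2 := WienerPhaseNoise.measurePreserving_shift (input.map fun x => x 0) n
  rwa [← hid] at h2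

/-- The channel is stationary. The time shift is a skew product over the shift of the increments
and the noise, whose fibre maps are rotations of the initial phase, and the uniform law on the
circle is invariant under rotations. -/
lemma measurePreserving_blockShift (β σN2 : ℝ) (L : ℕ) {input : Measure (ℕ → ℂ)}
    [IsProbabilityMeasure input] (h : IsIID input) (n : ℕ) :
    MeasurePreserving (blockShift L n) (reducedLaw β σN2 L input) (reducedLaw β σN2 L input) := by
  have hW := measurePreserving_shift
    (gaussianReal 0 (2 * Real.pi * β * (1 / L)).toNNReal) (n * L)
  have hZ := measurePreserving_shift (complexGaussian (σN2 * (1 / L))) (n * L)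
  have hWZ := hW.prod hZ
  have hm : Measurable (Function.uncurry fun (p : (ℕ → ℝ) × (ℕ → ℂ))
      (φ : AddCircle (2 * Real.pi)) =>
      φ + ((∑ i ∈ Finset.range (n * L), p.1 i : ℝ) : AddCircle (2 * Real.pi))) :=
    measurable_snd.add (measurable_angle_mk.comp (by fun_prop))
  have hskew := MeasurePreserving.skew_product hWZ (μc := uniformAngle) (μd := uniformAngle) hm
    (ae_of_all _ fun p => map_add_right_uniformAngle _)
  exact (h.measurePreserving_shift n).prod
    ((Measure.measurePreserving_swap.comp hskew).comp Measure.measurePreserving_swap)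

/-- The amplitude information between the block of `m` symbols that follows the first `n` symbols
and its output samples is that of the first `m` symbols. -/
lemma mutualInfo_shifted_block (β σN2 : ℝ) {L : ℕ} (hL : 0 < L) {input : Measure (ℕ → ℂ)}
    [IsProbabilityMeasure input] (h : IsIID input) (n m : ℕ) :
    mutualInfo (channelLaw β σN2 L input) (fun ω => fun k : Fin m => ‖ω.1 (n + k)‖)
      (fun ω => fun i : Fin (m * L) => output L ω (n * L + i)) =
    amplitudeInfo β σN2 L input m := by
  have hU : Measurable fun (q : ReducedSample) => fun k : Fin m => ‖q.1 k‖ := by fun_prop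
  have hV : Measurable fun (q : ReducedSample) => fun i : Fin (m * L) => reducedOutput L q i :=
    measurable_pi_iff.2 fun i => measurable_reducedOutput L i
  have hr := measurePreserving_reducePhase β σN2 L input
  have h1 := mutualInfo_comp_measurePreserving hr hU hV
  have h2 := mutualInfo_comp_measurePreserving
    ((measurePreserving_blockShift β σN2 L h n).comp hr) hU hV
  simp only [Function.comp_apply, reducedOutput_blockShift hL, reducedOutput_reducePhase]
    at h1 h2
  rw [amplitudeInfo]
  exact h2.trans h1.symm

/-- The amplitude information of an i.i.d. input is superadditive in the number of symbols. -/
lemma amplitudeInfo_add_le (β σN2 : ℝ) {L : ℕ} (hL : 0 < L) {input : Measure (ℕ → ℂ)}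
    [IsProbabilityMeasure input] (h : IsIID input)
    (hfin : ∀ n, amplitudeInfo β σN2 L input n ≠ ∞) (n m : ℕ) :
    amplitudeInfo β σN2 L input n + amplitudeInfo β σN2 L input m ≤
      amplitudeInfo β σN2 L input (n + m) := by
  have hshift := mutualInfo_shifted_block β σN2 hL h n m
  have hind : iIndepFun (fun (k : ℕ) (ω : Sample) => ‖ω.1 k‖) (channelLaw β σN2 L input) :=
    iIndepFun_comp_measurePreserving (measurePreserving_channelLaw_input β σN2 L input)
      (by fun_prop) (h.1.comp (fun _ z => ‖z‖) fun _ => measurable_norm)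
  have hind2 := hind.indepFun_finset (Finset.range n) (Finset.Ico n (n + m))
    (Finset.disjoint_left.2 fun i hi hi' =>
      (Finset.mem_range.1 hi).not_ge (Finset.mem_Ico.1 hi').1) (by fun_prop)
  have hind3 := hind2.comp
    (φ := fun (u : Finset.range n → ℝ) (k : Fin n) => u ⟨k, Finset.mem_range.2 k.2⟩)
    (ψ := fun (u : Finset.Ico n (n + m) → ℝ) (k : Fin m) =>
      u ⟨n + k, Finset.mem_Ico.2 ⟨Nat.le_add_right _ _, Nat.add_lt_add_left k.2 n⟩⟩)
    (by fun_prop) (by fun_prop)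
  have hb : ∀ i : Fin (n * L), (i : ℕ) < (n + m) * L := fun i => by
    have := i.2
    rw [add_mul]
    omega
  have hb' : ∀ i : Fin (m * L), n * L + (i : ℕ) < (n + m) * L := fun i => by
    have := i.2
    rw [add_mul]
    omega
  have hV : Measurable fun (ω : Sample) => fun i : Fin ((n + m) * L) => output L ω i :=
    measurable_pi_iff.2 fun i => measurable_output L i
  have main := mutualInfo_add_le (μ := channelLaw β σN2 L input)
    (U := fun ω => fun k : Fin (n + m) => ‖ω.1 k‖)
    (V := fun ω => fun i : Fin ((n + m) * L) => output L ω i)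
    (p₁ := fun u (k : Fin n) => u (Fin.castAdd m k)) (p₂ := fun u (k : Fin m) => u (Fin.natAdd n k))
    (s₁ := fun v (i : Fin (n * L)) => v ⟨i, hb i⟩)
    (s₂ := fun v (i : Fin (m * L)) => v ⟨n * L + i, hb' i⟩)
    (by fun_prop) hV (by fun_prop) (by fun_prop) (by fun_prop) (by fun_prop) hind3
    (hfin n) (hshift.trans_ne (hfin m))
  simp only [Fin.val_natAdd] at main
  rw [hshift] at main
  exact main

end Channel

/-! ### The density of the noise -/

section Densities

lemma pi_withDensity_ofReal {ι α : Type*} [Fintype ι] [MeasurableSpace α] (μ : Measure α)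
    [SigmaFinite μ] {f : α → ℝ} (hf : Integrable f μ) (h0 : ∀ x, 0 ≤ f x) :
    Measure.pi (fun _ : ι => μ.withDensity fun x => ENNReal.ofReal (f x)) =
      (Measure.pi fun _ : ι => μ).withDensity fun z => ENNReal.ofReal (∏ i, f (z i)) := by
  have : SigmaFinite (μ.withDensity fun x => ENNReal.ofReal (f x)) :=
    SigmaFinite.withDensity_ofReal _
  refine Measure.pi_eq fun s hs => ?_
  have hind : ∀ z : ι → α, (Set.univ.pi s).indicator (fun z => ENNReal.ofReal (∏ i, f (z i))) z =
      ENNReal.ofReal (∏ i, (s i).indicator f (z i)) := by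
    intro z
    by_cases hz : z ∈ Set.univ.pi s
    · rw [Set.indicator_of_mem hz]
      congr 1
      exact Finset.prod_congr rfl fun i _ => (Set.indicator_of_mem (hz i trivial) f).symm
    · rw [Set.indicator_of_notMem hz]
      obtain ⟨i, hi⟩ : ∃ i, z i ∉ s i := by simpa [Set.mem_pi] using hz
      rw [Finset.prod_eq_zero (Finset.mem_univ i) (Set.indicator_of_notMem hi f),
        ENNReal.ofReal_zero]
  have hi : ∀ i, Integrable ((s i).indicator f) μ := fun i => hf.indicator (hs i)
  have h0' : ∀ i x, 0 ≤ (s i).indicator f x := fun i x => Set.indicator_nonneg (fun x _ => h0 x) x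
  rw [withDensity_apply _ (MeasurableSet.univ_pi hs), ← lintegral_indicator (.univ_pi hs)]
  simp_rw [hind]
  rw [← ofReal_integral_eq_lintegral_ofReal (Integrable.fintype_prod hi)
      (ae_of_all _ fun z => Finset.prod_nonneg fun i _ => h0' i _),
    integral_fintype_prod_eq_prod, ENNReal.ofReal_prod_of_nonneg
      fun i _ => integral_nonneg (h0' i)]
  refine Finset.prod_congr rfl fun i _ => ?_
  rw [withDensity_apply _ (hs i), ← lintegral_indicator (hs i),
    ofReal_integral_eq_lintegral_ofReal (hi i) (ae_of_all _ (h0' i))]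
  refine lintegral_congr fun x => ?_
  by_cases hx : x ∈ s i <;> simp [hx]

lemma complexGaussian_eq_withDensity {v : ℝ} (hv : 0 < v) :
    complexGaussian v = (volume : Measure ℂ).withDensity fun z =>
      ENNReal.ofReal ((Real.pi * v)⁻¹ * Real.exp (-‖z‖ ^ 2 / v)) := by
  have hv2 : (v / 2).toNNReal ≠ 0 := by
    simpa using hv
  have hp : Measurable (gaussianPDF 0 (v / 2).toNNReal) := measurable_gaussianPDF _ _
  ext s hs
  rw [complexGaussian, gaussianReal_of_var_ne_zero 0 hv2, prod_withDensity hp hp,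
    MeasurableEquiv.map_apply,
    withDensity_apply _ (Complex.measurableEquivRealProd.symm.measurable hs),
    withDensity_apply _ hs,
    ← Complex.volume_preserving_equiv_real_prod.symm.setLIntegral_comp_preimage_emb
      (MeasurableEquiv.measurableEmbedding _)]
  refine setLIntegral_congr_fun (Complex.measurableEquivRealProd.symm.measurable hs) ?_
  rintro ⟨x, y⟩ -
  have hn : ‖(Complex.measurableEquivRealProd.symm (x, y) : ℂ)‖ ^ 2 = x ^ 2 + y ^ 2 := by
    rw [Complex.measurableEquivRealProd_symm_apply, Complex.sq_norm, Complex.normSq_mk]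
    ring
  simp only [gaussianPDF, gaussianPDFReal]
  rw [hn, ← ENNReal.ofReal_mul (by positivity), Real.coe_toNNReal _ (by positivity)]
  congr 1
  rw [show 2 * Real.pi * (v / 2) = Real.pi * v by ring, mul_mul_mul_comm, ← mul_inv,
    Real.mul_self_sqrt (by positivity), ← Real.exp_add]
  congr 2
  field_simp
  ring

end Densities

/-! ### An upper bound for channels with additive noise -/

section AdditiveNoise

variable {T E α : Type*} [MeasurableSpace T] [MeasurableSpace E] [AddCommGroup E]
  [MeasurableAdd₂ E] [MeasurableSub₂ E] [MeasurableSpace α]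

/-- Mutual information across a channel `Y = a + Z` with independent noise `Z` whose density `D`
with respect to a translation invariant measure is bounded by `K`, when the density of `Y` is at
least `K e ^ (-h)`. The likelihood ratio of `(A, Y)` is then at most `e ^ h`; the bound on it needs
no formula for the conditional law of `Y` given `A`, because the conditional density is an average
of translates of `D`. -/
lemma mutualInfo_additive_noise_le {τ : Measure T} [IsProbabilityMeasure τ] {vol : Measure E}
    [SigmaFinite vol] [vol.IsAddLeftInvariant] {D : E → ℝ≥0∞} (hD : Measurable D)
    {γ : Measure E} [IsProbabilityMeasure γ]
    (hγ : γ = vol.withDensity D) {a : T → E} (ha : Measurable a) {A : T → α}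
    (hA : Measurable A) {K : ℝ≥0∞} (hK : ∀ y, D y ≤ K) {h : E → ℝ} (hh : Measurable h)
    (h0 : ∀ y, 0 ≤ h y)
    (hlow : ∀ y, K ≤ (∫⁻ u, D (y - a u) ∂τ) * ENNReal.ofReal (Real.exp (h y))) :
    mutualInfo (τ.prod γ) (fun p => A p.1) (fun p => a p.1 + p.2) ≤
      ∫⁻ p, ENNReal.ofReal (h (a p.1 + p.2)) ∂(τ.prod γ) + 1 := by
  have hU : Measurable fun p : T × E => A p.1 := by fun_prop
  have hV : Measurable fun p : T × E => a p.1 + p.2 := by fun_prop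
  -- Integrals against the channel law, with the noise translated to the output.
  have hjoint : ∀ f : T × E → ℝ≥0∞, Measurable f →
      ∫⁻ p, f (p.1, a p.1 + p.2) ∂(τ.prod γ) =
        ∫⁻ u, ∫⁻ y, D (y - a u) * f (u, y) ∂vol ∂τ := by
    intro f hf
    rw [lintegral_prod _ (by fun_prop)]
    refine lintegral_congr fun u => ?_
    rw [hγ, lintegral_withDensity_eq_lintegral_mul _ hD (by fun_prop),
      ← lintegral_add_left_eq_self (fun y => D (y - a u) * f (u, y)) (a u)]
    simp
  have := Measure.isProbabilityMeasure_map (μ := τ.prod γ) hU.aemeasurable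
  have := Measure.isProbabilityMeasure_map (μ := τ.prod γ) hV.aemeasurable
  have := Measure.isProbabilityMeasure_map (μ := τ.prod γ)
    (hU.prodMk hV).aemeasurable
  have hmain := klDiv_le_of_le_withDensity
    (μ := (τ.prod γ).map fun p => (A p.1, a p.1 + p.2))
    (ν := ((τ.prod γ).map fun p => A p.1).prod
      ((τ.prod γ).map fun p => a p.1 + p.2))
    (h := fun z => h z.2) (by fun_prop) (fun z => h0 z.2) ?_
  · rw [lintegral_map (by fun_prop) (hU.prodMk hV)] at hmain
    exact hmain
  refine Measure.le_iff.2 fun s hs => ?_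
  have hs1 : Measurable (s.indicator (1 : α × E → ℝ≥0∞)) := measurable_one.indicator hs
  have hDm : Measurable fun p : T × E => D (p.2 - a p.1) := by fun_prop
  calc ((τ.prod γ).map fun p => (A p.1, a p.1 + p.2)) s
      = ∫⁻ u, ∫⁻ y, D (y - a u) * s.indicator 1 (A u, y) ∂vol ∂τ := by
        rw [← lintegral_indicator_one hs, lintegral_map hs1 (hU.prodMk hV)]
        exact hjoint (fun p => s.indicator 1 (A p.1, p.2)) (by fun_prop)
    _ ≤ ∫⁻ u, ∫⁻ y, (∫⁻ u', D (y - a u') ∂τ) *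
          (ENNReal.ofReal (Real.exp (h y)) * s.indicator 1 (A u, y)) ∂vol ∂τ := by
        refine lintegral_mono fun u => lintegral_mono fun y => ?_
        rw [← mul_assoc]
        exact mul_le_mul_left ((hK _).trans (hlow y)) _
    _ = ∫⁻ u, ∫⁻ p, ENNReal.ofReal (Real.exp (h (a p.1 + p.2))) *
          s.indicator 1 (A u, a p.1 + p.2) ∂(τ.prod γ) ∂τ := by
        refine lintegral_congr fun u => ?_
        have hφ : Measurable fun y =>
            ENNReal.ofReal (Real.exp (h y)) * s.indicator 1 (A u, y) := by fun_prop
        have e := hjoint (fun p => ENNReal.ofReal (Real.exp (h p.2)) * s.indicator 1 (A u, p.2))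
          (hφ.comp measurable_snd)
        refine Eq.trans ?_ e.symm
        rw [lintegral_lintegral_swap (hDm.mul (hφ.comp measurable_snd)).aemeasurable]
        refine lintegral_congr fun y => ?_
        exact (lintegral_mul_const _ (hDm.comp measurable_prodMk_right)).symm
    _ = (((τ.prod γ).map fun p => A p.1).prod
          ((τ.prod γ).map fun p => a p.1 + p.2)).withDensity
          (fun z => ENNReal.ofReal (Real.exp (h z.2))) s := by
        have hfst : (τ.prod γ).map (fun p => A p.1) = τ.map A := by
          rw [show (fun p : T × E => A p.1) = A ∘ Prod.fst from rfl,
            ← Measure.map_map hA measurable_fst, Measure.map_fst_prod]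
          simp
        have hm : Measurable fun z : α × E =>
            ENNReal.ofReal (Real.exp (h z.2)) * s.indicator 1 z := by fun_prop
        rw [hfst, withDensity_apply _ hs, ← lintegral_indicator hs]
        have hind : s.indicator (fun z : α × E => ENNReal.ofReal (Real.exp (h z.2))) =
            fun z => ENNReal.ofReal (Real.exp (h z.2)) * s.indicator 1 z := by
          ext z
          by_cases hz : z ∈ s <;> simp [hz]
        rw [hind, lintegral_prod _ hm.aemeasurable, lintegral_map hm.lintegral_prod_right' hA]
        refine lintegral_congr fun u => ?_
        rw [lintegral_map (by fun_prop) hV]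

end AdditiveNoise

/-! ### Moments of the noise and of the input -/

section Moments

lemma integral_complexGaussian (v : ℝ) (f : ℂ → ℝ) :
    ∫ z, f z ∂complexGaussian v = ∫ p, f (Complex.measurableEquivRealProd.symm p)
      ∂((gaussianReal 0 (v / 2).toNNReal).prod (gaussianReal 0 (v / 2).toNNReal)) :=
  (MeasurableEquiv.measurableEmbedding _).integral_map _

lemma memLp_complexGaussian (v : ℝ) (p : ℝ≥0∞) (hp : p ≠ ∞) :
    MemLp (fun z : ℂ => z) p (complexGaussian v) := by
  have hg := memLp_id_gaussianReal' (μ := 0) (v := (v / 2).toNNReal) p hp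
  have h1 := hg.comp_fst (gaussianReal 0 (v / 2).toNNReal)
  have h2 := hg.comp_snd (gaussianReal 0 (v / 2).toNNReal)
  rw [complexGaussian, MeasurableEquiv.memLp_map_measure_iff]
  refine MemLp.of_le (g := fun q : ℝ × ℝ => |q.1| + |q.2|) (h1.norm.add h2.norm)
    (MeasurableEquiv.measurable _).aestronglyMeasurable (ae_of_all _ fun q => ?_)
  refine (Complex.norm_le_abs_re_add_abs_im _).trans ?_
  simpa using le_abs_self _

lemma integrable_norm_pow_complexGaussian (v : ℝ) (k : ℕ) :
    Integrable (fun z : ℂ => ‖z‖ ^ k) (complexGaussian v) :=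
  (memLp_complexGaussian v k (by simp)).integrable_norm_pow'

lemma integral_norm_sq_complexGaussian {v : ℝ} (hv : 0 ≤ v) :
    ∫ z, ‖z‖ ^ 2 ∂complexGaussian v = v := by
  have hg : ∫ x, x ^ 2 ∂gaussianReal 0 (v / 2).toNNReal = v / 2 := by
    have h1 := variance_of_integral_eq_zero (X := fun x : ℝ => x)
      (μ := gaussianReal 0 (v / 2).toNNReal) (by fun_prop) (by simp)
    rw [variance_fun_id_gaussianReal, Real.coe_toNNReal _ (by positivity)] at h1
    exact h1.symm
  have hi : Integrable (fun x : ℝ => x ^ 2) (gaussianReal 0 (v / 2).toNNReal) :=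
    (memLp_id_gaussianReal' 2 (by simp)).integrable_sq
  rw [integral_complexGaussian]
  have : ∀ p : ℝ × ℝ, ‖(Complex.measurableEquivRealProd.symm p : ℂ)‖ ^ 2 = p.1 ^ 2 + p.2 ^ 2 := by
    intro p
    rw [Complex.measurableEquivRealProd_symm_apply, Complex.sq_norm, Complex.normSq_mk]
    ring
  simp_rw [this]
  rw [integral_add (hi.comp_fst _) (hi.comp_snd _), integral_fun_fst (fun x => x ^ 2),
    integral_fun_snd (fun x => x ^ 2), hg]
  simp

lemma complexGaussian_eq_map_smul {v : ℝ} (hv : 0 ≤ v) :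
    complexGaussian v = (complexGaussian 1).map fun z => √v • z := by
  have hg : gaussianReal 0 (v / 2).toNNReal =
      (gaussianReal 0 (1 / 2 : ℝ).toNNReal).map (√v * ·) := by
    rw [gaussianReal_map_const_mul]
    congr 1
    · simp
    · ext
      simp [Real.sq_sqrt hv, hv, div_eq_mul_inv]
  have hm : Measurable fun x : ℝ => √v * x := by fun_prop
  rw [complexGaussian, complexGaussian, hg, Measure.map_prod_map _ _ hm hm,
    Measure.map_map (MeasurableEquiv.measurable _) (hm.prodMap hm),
    Measure.map_map (by fun_prop) (MeasurableEquiv.measurable _)]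
  congr 1
  ext p
  apply Complex.ext <;> simp [Complex.measurableEquivRealProd_symm_apply]

/-- Moments of the complex Gaussian law scale with the variance. -/
lemma integral_norm_pow_four_complexGaussian {v : ℝ} (hv : 0 ≤ v) :
    ∫ z, ‖z‖ ^ 4 ∂complexGaussian v = v ^ 2 * ∫ z, ‖z‖ ^ 4 ∂complexGaussian 1 := by
  rw [complexGaussian_eq_map_smul hv, integral_map (by fun_prop) (by fun_prop),
    ← integral_const_mul]
  refine integral_congr_ae (ae_of_all _ fun z => ?_)
  simp only [norm_smul, mul_pow, Real.norm_eq_abs, abs_of_nonneg (Real.sqrt_nonneg v)]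
  rw [show √v ^ 4 = (√v ^ 2) ^ 2 by ring, Real.sq_sqrt hv]

lemma integral_re_mul_complexGaussian {v : ℝ} (b : ℂ) :
    ∫ z, (b * z).re ∂complexGaussian v = 0 := by
  have hi : Integrable (fun x : ℝ => x) (gaussianReal 0 (v / 2).toNNReal) :=
    (memLp_id_gaussianReal' 1 (by simp)).integrable le_rfl
  rw [integral_complexGaussian]
  have : ∀ p : ℝ × ℝ, (b * Complex.measurableEquivRealProd.symm p).re =
      b.re * p.1 - b.im * p.2 := by
    intro p
    simp [Complex.measurableEquivRealProd_symm_apply]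
  simp_rw [this]
  rw [integral_sub ((hi.comp_fst _).const_mul _) ((hi.comp_snd _).const_mul _),
    integral_const_mul, integral_const_mul, integral_fun_fst (fun x => x),
    integral_fun_snd (fun x => x)]
  simp

/-- The mean of the shifted exponential law is `P`. -/
lemma integrable_and_integral_shiftedExp {P : ℝ} (hP : 0 < P) :
    Integrable (fun u : ℝ => u) (shiftedExp P) ∧ ∫ u, u ∂shiftedExp P = P := by
  -- An antiderivative of `u` times the density.
  have hd : ∀ u ∈ Set.Ici (P / 2), HasDerivAt (fun u => -((u + P / 2) * Real.exp (1 - 2 * u / P)))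
      (2 / P * Real.exp (1 - 2 * u / P) * u) u := by
    intro u _
    have h1 : HasDerivAt (fun u : ℝ => 1 - 2 * u / P) (-(2 / P)) u := by
      have := (((hasDerivAt_id u).const_mul 2).div_const P).const_sub 1
      simpa using this
    convert! (((hasDerivAt_id u).add_const (P / 2)).mul h1.exp).neg using 1
    simp only [id]
    field_simp
    ring
  have hpos : ∀ u ∈ Set.Ioi (P / 2), 0 ≤ 2 / P * Real.exp (1 - 2 * u / P) * u := by
    intro u hu
    have : 0 < u := (half_pos hP).trans hu
    positivity
  have hlim : Tendsto (fun u => -((u + P / 2) * Real.exp (1 - 2 * u / P))) atTop (𝓝 0) := by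
    have h1 : Tendsto (fun u : ℝ => 2 * u / P) atTop atTop :=
      (tendsto_id.const_mul_atTop (by norm_num)).atTop_div_const hP
    have h2 := (Real.tendsto_pow_mul_exp_neg_atTop_nhds_zero 1).comp h1
    have h3 := (Real.tendsto_pow_mul_exp_neg_atTop_nhds_zero 0).comp h1
    have h4 := ((h2.const_mul (P / 2)).add (h3.const_mul (P / 2))).const_mul (-Real.exp 1)
    simp only [mul_zero, add_zero] at h4
    refine h4.congr fun u => ?_
    simp only [Function.comp_apply, pow_one, pow_zero, one_mul, sub_eq_add_neg, Real.exp_add]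
    field_simp
  have hint := integrableOn_Ioi_deriv_of_nonneg' hd hpos hlim
  have hval := integral_Ioi_of_hasDerivAt_of_nonneg' hd hpos hlim
  have hdens : Measurable fun u : ℝ => if P / 2 ≤ u then 2 / P * Real.exp (1 - 2 * u / P) else 0 :=
    Measurable.ite measurableSet_Ici (by fun_prop) measurable_const
  have h0 : ∀ u : ℝ, 0 ≤ if P / 2 ≤ u then 2 / P * Real.exp (1 - 2 * u / P) else 0 := by
    intro u
    split_ifs <;> positivity
  have heq : (fun u : ℝ => (if P / 2 ≤ u then 2 / P * Real.exp (1 - 2 * u / P) else 0) • u) =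
      (Set.Ici (P / 2)).indicator fun u => 2 / P * Real.exp (1 - 2 * u / P) * u := by
    ext u
    by_cases hu : P / 2 ≤ u <;> simp [hu]
  constructor
  · rw [shiftedExp, integrable_withDensity_iff_integrable_smul' (by fun_prop) (by simp)]
    simp only [ENNReal.toReal_ofReal (h0 _)]
    rw [heq, integrable_indicator_iff measurableSet_Ici, integrableOn_Ici_iff_integrableOn_Ioi]
    exact hint
  · rw [shiftedExp, integral_withDensity_eq_integral_toReal_smul (by fun_prop) (by simp)]
    simp only [ENNReal.toReal_ofReal (h0 _)]
    rw [heq, integral_indicator measurableSet_Ici, integral_Ici_eq_integral_Ioi, hval]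
    rw [show 1 - 2 * (P / 2) / P = 0 by field_simp; ring]
    simp

lemma HasShiftedExpAmplitudes.integrable_norm_sq {P : ℝ} (hP : 0 < P) {input : Measure (ℕ → ℂ)}
    (h : HasShiftedExpAmplitudes P input) (k : ℕ) :
    Integrable (fun x : ℕ → ℂ => ‖x k‖ ^ 2) input := by
  have := (integrable_and_integral_shiftedExp hP).1
  rw [← h.2 k] at this
  exact this.comp_measurable (by fun_prop)

lemma HasShiftedExpAmplitudes.integral_norm_sq {P : ℝ} (hP : 0 < P) {input : Measure (ℕ → ℂ)}
    (h : HasShiftedExpAmplitudes P input) (k : ℕ) : ∫ x, ‖x k‖ ^ 2 ∂input = P := by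
  have := (integrable_and_integral_shiftedExp hP).2
  rw [← h.2 k, integral_map (by fun_prop : Measurable _).aemeasurable (by fun_prop)] at this
  exact this

end Moments

/-! ### Separation of the signal from the noise -/

section Decoupling

/-- What determines the noise-free output: the input symbols, the initial phase and the phase
increments. -/
abbrev Transmission : Type := (ℕ → ℂ) × ℝ × (ℕ → ℝ)

/-- The law of the transmission. -/
noncomputable def transmissionLaw (β : ℝ) (L : ℕ) (input : Measure (ℕ → ℂ)) :
    Measure Transmission :=
  input.prod (uniformPhase.prod
    (Measure.infinitePi fun _ : ℕ => gaussianReal 0 (2 * Real.pi * β * (1 / L)).toNNReal))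

instance (β : ℝ) (L : ℕ) (input : Measure (ℕ → ℂ)) [IsProbabilityMeasure input] :
    IsProbabilityMeasure (transmissionLaw β L input) := by
  unfold transmissionLaw
  infer_instance

/-- The noise-free output sample of index `k`. -/
noncomputable def signal (L : ℕ) (t : Transmission) (k : ℕ) : ℂ :=
  t.1 (k / L) * ((1 / L : ℝ) : ℂ) *
    Complex.exp (Complex.I * ((t.2.1 + ∑ i ∈ Finset.range k, t.2.2 i : ℝ) : ℂ))

/-- The transmission together with the noise samples selected by `e`. -/
def decouple {ι : Type*} (e : ι → ℕ) (ω : Sample) : Transmission × (ι → ℂ) :=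
  ((ω.1, ω.2.1, ω.2.2.1), fun i => ω.2.2.2 (e i))

lemma measurable_signal (L k : ℕ) : Measurable fun t => signal L t k := by
  unfold signal
  fun_prop

lemma norm_signal_sq (L : ℕ) (t : Transmission) (k : ℕ) :
    ‖signal L t k‖ ^ 2 = ‖t.1 (k / L)‖ ^ 2 / L ^ 2 := by
  rw [signal, norm_mul, mul_comm Complex.I, Complex.norm_exp_ofReal_mul_I, norm_mul]
  simp [div_eq_mul_inv, mul_pow]

lemma output_eq_signal_add {ι : Type*} (L : ℕ) (e : ι → ℕ) (ω : Sample) (i : ι) :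
    output L ω (e i) = signal L (decouple e ω).1 (e i) + (decouple e ω).2 i := by
  simp [output, signal, decouple, phase_eq_add_sum]

lemma measurePreserving_decouple (β σN2 : ℝ) (L : ℕ) (input : Measure (ℕ → ℂ))
    [IsProbabilityMeasure input] {ι : Type*} [Fintype ι] {e : ι → ℕ} (he : Function.Injective e) :
    MeasurePreserving (decouple e) (channelLaw β σN2 L input)
      ((transmissionLaw β L input).prod
        (Measure.pi fun _ : ι => complexGaussian (σN2 * (1 / L)))) := by
  have hz : MeasurePreserving (fun (z : ℕ → ℂ) i => z (e i))
      (Measure.infinitePi fun _ : ℕ => complexGaussian (σN2 * (1 / L)))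
      (Measure.pi fun _ : ι => complexGaussian (σN2 * (1 / L))) := by
    refine ⟨by fun_prop, ?_⟩
    rw [Measure.map_infinitePi_infinitePi_of_inj he, Measure.infinitePi_eq_pi]
  have h1 := (measurePreserving_prodAssoc uniformPhase
    (Measure.infinitePi fun _ : ℕ => gaussianReal 0 (2 * Real.pi * β * (1 / L)).toNNReal)
    (Measure.infinitePi fun _ : ℕ => complexGaussian (σN2 * (1 / L)))).symm
  have h2 := (measurePreserving_prodAssoc input (uniformPhase.prod
    (Measure.infinitePi fun _ : ℕ => gaussianReal 0 (2 * Real.pi * β * (1 / L)).toNNReal))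
    (Measure.infinitePi fun _ : ℕ => complexGaussian (σN2 * (1 / L)))).symm
  have h3 := h2.comp ((MeasurePreserving.id input).prod h1)
  exact ((MeasurePreserving.id _).prod hz).comp h3

lemma measurePreserving_transmission_input (β : ℝ) (L : ℕ) (input : Measure (ℕ → ℂ))
    [IsProbabilityMeasure input] :
    MeasurePreserving (Prod.fst : Transmission → ℕ → ℂ) (transmissionLaw β L input) input :=
  measurePreserving_fst

variable {β P : ℝ} {L : ℕ} {input : Measure (ℕ → ℂ)} [IsProbabilityMeasure input]

lemma integral_norm_sq_symbol (hP : 0 < P) (h : HasShiftedExpAmplitudes P input) (k : ℕ) :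
    ∫ t, ‖t.1 k‖ ^ 2 ∂transmissionLaw β L input = P := by
  rw [← h.integral_norm_sq hP k]
  conv_rhs => rw [← (measurePreserving_transmission_input β L input).map_eq]
  rw [integral_map measurable_fst.aemeasurable
    (by fun_prop : Measurable fun x : ℕ → ℂ => ‖x k‖ ^ 2).aestronglyMeasurable]

lemma integrable_norm_signal_sq (hP : 0 < P) (h : HasShiftedExpAmplitudes P input) (k : ℕ) :
    Integrable (fun t => ‖signal L t k‖ ^ 2) (transmissionLaw β L input) := by
  simp_rw [norm_signal_sq]
  exact ((measurePreserving_transmission_input β L input).integrable_comp_of_integrable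
    (h.integrable_norm_sq hP (k / L))).div_const _

lemma integral_norm_signal_sq (hP : 0 < P) (h : HasShiftedExpAmplitudes P input) (k : ℕ) :
    ∫ t, ‖signal L t k‖ ^ 2 ∂transmissionLaw β L input = P / L ^ 2 := by
  simp_rw [norm_signal_sq]
  rw [integral_div, integral_norm_sq_symbol hP h]

end Decoupling

/-! ### Linear growth of the information -/

section Finiteness

/-- Jensen's inequality for the exponential, as a lower bound on a lower integral. -/
lemma ofReal_exp_neg_integral_le {T : Type*} [MeasurableSpace T] {τ : Measure T}
    [IsProbabilityMeasure τ] {S : T → ℝ} (hS : Integrable S τ) (h0 : ∀ u, 0 ≤ S u) :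
    ENNReal.ofReal (Real.exp (-∫ u, S u ∂τ)) ≤ ∫⁻ u, ENNReal.ofReal (Real.exp (-S u)) ∂τ := by
  have hi : Integrable (fun u => Real.exp (-S u)) τ := by
    refine Integrable.of_bound (C := 1)
      (Real.continuous_exp.comp_aestronglyMeasurable hS.aestronglyMeasurable.neg)
      (ae_of_all _ fun u => ?_)
    rw [Real.norm_eq_abs, Real.abs_exp, Real.exp_le_one_iff]
    linarith [h0 u]
  rw [← ofReal_integral_eq_lintegral_ofReal hi (ae_of_all _ fun u => (Real.exp_pos _).le),
    ← integral_neg]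
  exact ENNReal.ofReal_le_ofReal (convexOn_exp.map_integral_le Real.continuous_exp.continuousOn
    isClosed_univ (by simp) hS.neg hi)

lemma norm_sub_sq_le {E : Type*} [SeminormedAddCommGroup E] (a b : E) :
    ‖a - b‖ ^ 2 ≤ 2 * ‖a‖ ^ 2 + 2 * ‖b‖ ^ 2 := by
  have := norm_sub_le a b
  nlinarith [norm_nonneg (a - b), sq_nonneg (‖a‖ - ‖b‖)]

lemma norm_add_sq_le {E : Type*} [SeminormedAddCommGroup E] (a b : E) :
    ‖a + b‖ ^ 2 ≤ 2 * ‖a‖ ^ 2 + 2 * ‖b‖ ^ 2 := by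
  simpa using norm_sub_sq_le a (-b)

/-- The amplitude information grows at most linearly in the number of symbols. -/
lemma exists_amplitudeInfo_le (β : ℝ) {σN2 P : ℝ} (hσ : 0 < σN2) (hP : 0 < P) {L : ℕ} (hL : 0 < L)
    {input : Measure (ℕ → ℂ)} [IsProbabilityMeasure input]
    (h : HasShiftedExpAmplitudes P input) :
    ∃ C : ℝ, 0 ≤ C ∧ ∀ n : ℕ, amplitudeInfo β σN2 L input n ≤ ENNReal.ofReal (n * C) + 1 := by
  have hLr : (0 : ℝ) < L := by exact_mod_cast hL
  have hv : 0 < σN2 * (1 / L) := by positivity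
  set v := σN2 * (1 / (L : ℝ)) with hvdef
  refine ⟨L * (2 / v * (3 * (P / L ^ 2) + 2 * v)), by positivity, fun n => ?_⟩
  have hmp := measurePreserving_decouple β σN2 L input (e := fun i : Fin (n * L) => (i : ℕ))
    Fin.val_injective
  rw [← hvdef] at hmp
  set τ := transmissionLaw β L input
  set γ := Measure.pi fun _ : Fin (n * L) => complexGaussian v with hγdef
  let a : Transmission → Fin (n * L) → ℂ := fun t i => signal L t i
  have ha : Measurable a := measurable_pi_iff.2 fun i => measurable_signal L i
  -- The density of the noise and its supremum.
  have hpi : Integrable (fun z : ℂ => (Real.pi * v)⁻¹ * Real.exp (-‖z‖ ^ 2 / v)) := by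
    have h1 : IsFiniteMeasure ((volume : Measure ℂ).withDensity fun z =>
        ENNReal.ofReal ((Real.pi * v)⁻¹ * Real.exp (-‖z‖ ^ 2 / v))) := by
      rw [← complexGaussian_eq_withDensity hv]
      infer_instance
    refine ⟨by fun_prop, ?_⟩
    rw [hasFiniteIntegral_iff_ofReal (ae_of_all _ fun z => by positivity)]
    simpa using measure_lt_top ((volume : Measure ℂ).withDensity fun z =>
        ENNReal.ofReal ((Real.pi * v)⁻¹ * Real.exp (-‖z‖ ^ 2 / v))) Set.univ
  let K : ℝ := ((Real.pi * v)⁻¹) ^ (n * L)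
  have hK0 : 0 < K := by positivity
  let D : (Fin (n * L) → ℂ) → ℝ≥0∞ := fun z =>
    ENNReal.ofReal (K * Real.exp (-(∑ i, ‖z i‖ ^ 2) / v))
  have hD : Measurable D := by fun_prop
  have hγ : γ = (volume : Measure (Fin (n * L) → ℂ)).withDensity D := by
    rw [hγdef, complexGaussian_eq_withDensity hv,
      pi_withDensity_ofReal _ hpi fun z => by positivity, ← volume_pi]
    congr 1
    ext z
    simp only [D, K]
    rw [Finset.prod_mul_distrib, ← Real.exp_sum, Finset.prod_const, Finset.card_univ,
      Fintype.card_fin, neg_div, Finset.sum_div, ← Finset.sum_neg_distrib]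
    simp only [neg_div]
  -- The bound on the log-likelihood ratio, from `‖y - a‖² ≤ 2 ‖y‖² + 2 ‖a‖²` and Jensen's
  -- inequality for the average over the signal `a`.
  let H : (Fin (n * L) → ℂ) → ℝ := fun y =>
    2 / v * (∑ i, ‖y i‖ ^ 2) + 2 / v * ((n * L : ℕ) * (P / L ^ 2))
  have hS : Integrable (fun t => 2 / v * ∑ i, ‖a t i‖ ^ 2) τ :=
    (integrable_finsetSum _ fun i _ => integrable_norm_signal_sq hP h _).const_mul _
  have hSval : ∫ t, ∑ i, ‖a t i‖ ^ 2 ∂τ = (n * L : ℕ) * (P / L ^ 2) := by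
    rw [integral_finsetSum _ fun i _ => integrable_norm_signal_sq hP h _]
    simp only [integral_norm_signal_sq hP h, Finset.sum_const, Finset.card_univ,
      Fintype.card_fin, nsmul_eq_mul]
  have hlow : ∀ y, ENNReal.ofReal K ≤
      (∫⁻ u, D (y - a u) ∂τ) * ENNReal.ofReal (Real.exp (H y)) := by
    intro y
    have hJ := ofReal_exp_neg_integral_le hS fun t => by positivity
    rw [integral_const_mul, hSval] at hJ
    have hpt : ∀ u, ENNReal.ofReal (K * Real.exp (-(2 / v * ∑ i, ‖y i‖ ^ 2))) *
        ENNReal.ofReal (Real.exp (-(2 / v * ∑ i, ‖a u i‖ ^ 2))) ≤ D (y - a u) := by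
      intro u
      rw [← ENNReal.ofReal_mul (by positivity), mul_assoc, ← Real.exp_add]
      refine ENNReal.ofReal_le_ofReal (mul_le_mul_of_nonneg_left (Real.exp_le_exp.2 ?_) hK0.le)
      have : ∑ i, ‖(y - a u) i‖ ^ 2 ≤ 2 * ∑ i, ‖y i‖ ^ 2 + 2 * ∑ i, ‖a u i‖ ^ 2 := by
        rw [Finset.mul_sum, Finset.mul_sum, ← Finset.sum_add_distrib]
        exact Finset.sum_le_sum fun i _ => norm_sub_sq_le _ _
      have := div_le_div_of_nonneg_right this hv.le
      calc _ = -((2 * ∑ i, ‖y i‖ ^ 2 + 2 * ∑ i, ‖a u i‖ ^ 2) / v) := by ring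
        _ ≤ -((∑ i, ‖(y - a u) i‖ ^ 2) / v) := neg_le_neg this
        _ = _ := by ring
    have hint := lintegral_mono (μ := τ) hpt
    rw [lintegral_const_mul _ (by fun_prop)] at hint
    refine le_trans ?_ (mul_le_mul_left ((mul_le_mul_right hJ _).trans hint) _)
    rw [← ENNReal.ofReal_mul (by positivity), ← ENNReal.ofReal_mul (by positivity)]
    refine ENNReal.ofReal_le_ofReal (le_of_eq ?_)
    rw [mul_assoc K, mul_assoc K, ← Real.exp_add, ← Real.exp_add]
    simp only [H]
    rw [show ∀ x y : ℝ, -x + -y + (x + y) = 0 by intros; ring]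
    simp
  have hmain := mutualInfo_additive_noise_le (τ := τ) (vol := volume) hD hγ ha
    (A := fun t => fun k : Fin n => ‖t.1 k‖) (by fun_prop) (K := ENNReal.ofReal K)
    (fun y => ENNReal.ofReal_le_ofReal (mul_le_of_le_one_right hK0.le (Real.exp_le_one_iff.2
      (div_nonpos_of_nonpos_of_nonneg (neg_nonpos.2 (by positivity)) hv.le))))
    (h := H) (by fun_prop) (fun y => by positivity) hlow
  have hinfo : amplitudeInfo β σN2 L input n =
      mutualInfo (τ.prod γ) (fun p => fun k : Fin n => ‖p.1.1 k‖) (fun p => a p.1 + p.2) := by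
    rw [← mutualInfo_comp_measurePreserving hmp (by fun_prop) (by fun_prop), amplitudeInfo]
    refine congrArg (mutualInfo _ _) ?_
    ext ω i
    exact output_eq_signal_add L (fun i : Fin (n * L) => (i : ℕ)) ω i
  rw [hinfo]
  refine hmain.trans (add_le_add_left ?_ 1)
  -- The mean of that bound under the channel law.
  have hZ : ∀ i : Fin (n * L), Integrable (fun z : Fin (n * L) → ℂ => ‖z i‖ ^ 2) γ := fun i =>
    integrable_comp_eval (μ := fun _ : Fin (n * L) => complexGaussian v) (f := fun z : ℂ => ‖z‖ ^ 2)
      (integrable_norm_pow_complexGaussian v 2)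
  have hZval : ∫ z, ∑ i, ‖z i‖ ^ 2 ∂γ = (n * L : ℕ) * v := by
    rw [integral_finsetSum _ fun i _ => hZ i]
    have : ∀ i : Fin (n * L), ∫ z, ‖z i‖ ^ 2 ∂γ = v := fun i => by
      rw [hγdef, integral_comp_eval (μ := fun _ : Fin (n * L) => complexGaussian v)
        (f := fun z : ℂ => ‖z‖ ^ 2) (by fun_prop),
        integral_norm_sq_complexGaussian hv.le]
    simp [this]
  have hS' : Integrable (fun t => ∑ i, ‖a t i‖ ^ 2) τ :=
    integrable_finsetSum _ fun i _ => integrable_norm_signal_sq hP h _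
  have hZ' : Integrable (fun z : Fin (n * L) → ℂ => ∑ i, ‖z i‖ ^ 2) γ :=
    integrable_finsetSum _ fun i _ => hZ i
  have hE : Integrable (fun p : Transmission × (Fin (n * L) → ℂ) =>
      2 / v * (2 * (∑ i, ‖a p.1 i‖ ^ 2) + 2 * ∑ i, ‖p.2 i‖ ^ 2)) (τ.prod γ) :=
    (((hS'.comp_fst γ).const_mul 2).add ((hZ'.comp_snd τ).const_mul 2)).const_mul _
  have hG : Integrable (fun p : Transmission × (Fin (n * L) → ℂ) =>
      2 / v * (2 * (∑ i, ‖a p.1 i‖ ^ 2) + 2 * ∑ i, ‖p.2 i‖ ^ 2) +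
        2 / v * ((n * L : ℕ) * (P / L ^ 2))) (τ.prod γ) :=
    hE.add (integrable_const _)
  calc ∫⁻ p, ENNReal.ofReal (H (a p.1 + p.2)) ∂(τ.prod γ)
      ≤ ∫⁻ p, ENNReal.ofReal (2 / v * (2 * (∑ i, ‖a p.1 i‖ ^ 2) + 2 * ∑ i, ‖p.2 i‖ ^ 2) +
        2 / v * ((n * L : ℕ) * (P / L ^ 2))) ∂(τ.prod γ) := by
        refine lintegral_mono fun p => ENNReal.ofReal_le_ofReal ?_
        have : ∑ i, ‖(a p.1 + p.2) i‖ ^ 2 ≤ 2 * ∑ i, ‖a p.1 i‖ ^ 2 + 2 * ∑ i, ‖p.2 i‖ ^ 2 := by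
          rw [Finset.mul_sum, Finset.mul_sum, ← Finset.sum_add_distrib]
          exact Finset.sum_le_sum fun i _ => norm_add_sq_le _ _
        simp only [H]
        gcongr
    _ = ENNReal.ofReal (n * (L * (2 / v * (3 * (P / L ^ 2) + 2 * v)))) := by
        rw [← ofReal_integral_eq_lintegral_ofReal hG (ae_of_all _ fun p => by positivity)]
        congr 1
        rw [integral_add hE (integrable_const _), integral_const_mul,
          integral_add ((hS'.comp_fst γ).const_mul 2) ((hZ'.comp_snd τ).const_mul 2),
          integral_const_mul, integral_const_mul,
          integral_fun_fst (fun t => ∑ i, ‖a t i‖ ^ 2),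
          integral_fun_snd (fun z : Fin (n * L) → ℂ => ∑ i, ‖z i‖ ^ 2), hSval, hZval]
        simp
        ring

end Finiteness

/-! ### Existence of the information rate -/

section Rate

/-- A superadditive sequence of extended nonnegative reals of at most linear growth has a finite
mean growth rate. -/
lemma tendsto_div_of_superadditive {a : ℕ → ℝ≥0∞} {C : ℝ} (hC : 0 ≤ C)
    (hle : ∀ n, a n ≤ ENNReal.ofReal (n * C) + 1) (hadd : ∀ n m, a n + a m ≤ a (n + m)) :
    ∃ l : ℝ≥0∞, l ≠ ∞ ∧ Tendsto (fun n : ℕ => a n / n) atTop (𝓝 l) := by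
  have hfin : ∀ n, a n ≠ ∞ := fun n => ne_top_of_le_ne_top (by finiteness) (hle n)
  have hsub : Subadditive fun n => -(a n).toReal := by
    intro m n
    have := ENNReal.toReal_mono (hfin (m + n)) (hadd m n)
    rw [ENNReal.toReal_add (hfin m) (hfin n)] at this
    linarith
  have hbdd : BddBelow (Set.range fun n : ℕ => -(a n).toReal / n) := by
    refine ⟨-(C + 1), ?_⟩
    rintro _ ⟨n, rfl⟩
    rcases n.eq_zero_or_pos with rfl | hn
    · simp
      linarith
    have hn1 : (1 : ℝ) ≤ n := by exact_mod_cast hn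
    have := ENNReal.toReal_mono (by finiteness) (hle n)
    rw [ENNReal.toReal_add (by finiteness) (by finiteness),
      ENNReal.toReal_ofReal (by positivity)] at this
    simp only [ENNReal.toReal_one] at this
    rw [le_div_iff₀ (by linarith)]
    nlinarith
  have hlim := hsub.tendsto_lim hbdd
  refine ⟨ENNReal.ofReal (-hsub.lim), by simp, ?_⟩
  refine (ENNReal.tendsto_ofReal hlim.neg).congr' ?_
  filter_upwards [eventually_gt_atTop 0] with n hn
  have hn' : (0 : ℝ) < n := by exact_mod_cast hn
  rw [← neg_div, neg_neg, ENNReal.ofReal_div_of_pos hn', ENNReal.ofReal_toReal (hfin n),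
    ENNReal.ofReal_natCast]

/-- For an i.i.d. input the information rate is finite and is a limit. -/
lemma amplitudeRate_ne_top_and_tendsto (β : ℝ) {σN2 P : ℝ} (hσ : 0 < σN2) (hP : 0 < P) {L : ℕ}
    (hL : 0 < L) {input : Measure (ℕ → ℂ)} [IsProbabilityMeasure input]
    (h : HasShiftedExpAmplitudes P input) (hiid : IsIID input) :
    amplitudeRate β σN2 L input ≠ ∞ ∧
      Tendsto (fun n : ℕ => amplitudeInfo β σN2 L input n / n) atTop
        (𝓝 (amplitudeRate β σN2 L input)) := by
  obtain ⟨C, hC, hle⟩ := exists_amplitudeInfo_le β hσ hP hL h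
  have hfin : ∀ n, amplitudeInfo β σN2 L input n ≠ ∞ := fun n =>
    ne_top_of_le_ne_top (by finiteness) (hle n)
  obtain ⟨l, hl, hlim⟩ :=
    tendsto_div_of_superadditive hC hle (amplitudeInfo_add_le β σN2 hL hiid hfin)
  have : amplitudeRate β σN2 L input = l := hlim.liminf_eq
  rw [this]
  exact ⟨hl, hlim⟩

end Rate

/-! ### Concentration of the block energy -/

section EnergyVariance

lemma memLp_two_noise_energy (v : ℝ) (a : ℂ) :
    MemLp (fun z : ℂ => ‖a + z‖ ^ 2 - ‖a‖ ^ 2 - v) 2 (complexGaussian v) := by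
  have h1 : MemLp (fun z : ℂ => a + z) 4 (complexGaussian v) :=
    (memLp_const a).add (memLp_complexGaussian v 4 (by simp))
  have h2 : MemLp (fun z : ℂ => ‖a + z‖ ^ 2) 2 (complexGaussian v) := by
    rw [memLp_two_iff_integrable_sq (by fun_prop)]
    simp_rw [← pow_mul]
    exact h1.integrable_norm_pow' (p := 4)
  exact (h2.sub (memLp_const _)).sub (memLp_const _)

lemma norm_add_sq_eq (a z : ℂ) :
    ‖a + z‖ ^ 2 = ‖a‖ ^ 2 + 2 * (starRingEnd ℂ a * z).re + ‖z‖ ^ 2 := by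
  rw [Complex.sq_norm, Complex.sq_norm, Complex.sq_norm, Complex.normSq_add]
  have : (a * starRingEnd ℂ z).re = (starRingEnd ℂ a * z).re := by simp
  rw [this]
  ring

/-- The excess energy of a sample, given the signal `a`, is centred. -/
lemma integral_noise_energy {v : ℝ} (hv : 0 ≤ v) (a : ℂ) :
    ∫ z, (‖a + z‖ ^ 2 - ‖a‖ ^ 2 - v) ∂complexGaussian v = 0 := by
  have hre : Integrable (fun z : ℂ => (starRingEnd ℂ a * z).re) (complexGaussian v) :=
    (((memLp_complexGaussian v 1 (by simp)).integrable le_rfl).const_mul _).re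
  have h2 := integrable_norm_pow_complexGaussian v 2
  have : ∀ z : ℂ, ‖a + z‖ ^ 2 - ‖a‖ ^ 2 - v = 2 * (starRingEnd ℂ a * z).re + (‖z‖ ^ 2 - v) := by
    intro z
    rw [norm_add_sq_eq]
    ring
  have h3 : Integrable (fun z : ℂ => ‖z‖ ^ 2 - v) (complexGaussian v) :=
    h2.sub (integrable_const v)
  simp_rw [this]
  rw [integral_add (hre.const_mul 2) h3, integral_const_mul,
    integral_re_mul_complexGaussian, integral_sub h2 (integrable_const v),
    integral_norm_sq_complexGaussian hv]
  simp

/-- The two terms of the excess energy are separated by `(a + b)² ≤ 2 a² + 2 b²`, at the cost of a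
factor `2` that the final constant can afford. -/
lemma variance_noise_energy_le {v : ℝ} (hv : 0 ≤ v) (a : ℂ) :
    Var[fun z : ℂ => ‖a + z‖ ^ 2 - ‖a‖ ^ 2 - v; complexGaussian v] ≤
      8 * ‖a‖ ^ 2 * v + 2 * v ^ 2 * ∫ z, ‖z‖ ^ 4 ∂complexGaussian 1 := by
  have h2 := integrable_norm_pow_complexGaussian v 2
  have h4 := integrable_norm_pow_complexGaussian v 4
  have hsq : Integrable (fun z : ℂ => (‖z‖ ^ 2 - v) ^ 2) (complexGaussian v) := by
    refine ((h4.sub (h2.const_mul (2 * v))).add (integrable_const (v ^ 2))).congr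
      (ae_of_all _ fun z => ?_)
    simp only [Pi.add_apply, Pi.sub_apply]
    ring
  have hsqval : ∫ z, (‖z‖ ^ 2 - v) ^ 2 ∂complexGaussian v ≤
      v ^ 2 * ∫ z, ‖z‖ ^ 4 ∂complexGaussian 1 := by
    have : ∀ z : ℂ, (‖z‖ ^ 2 - v) ^ 2 = ‖z‖ ^ 4 - 2 * v * ‖z‖ ^ 2 + v ^ 2 := fun z => by ring
    have h5 : Integrable (fun z : ℂ => ‖z‖ ^ 4 - 2 * v * ‖z‖ ^ 2) (complexGaussian v) :=
      h4.sub (h2.const_mul (2 * v))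
    simp_rw [this]
    rw [integral_add h5 (integrable_const _),
      integral_sub h4 (h2.const_mul (2 * v)), integral_const_mul,
      integral_norm_sq_complexGaussian hv, integral_norm_pow_four_complexGaussian hv]
    simp
    nlinarith [sq_nonneg v]
  rw [variance_of_integral_eq_zero (by fun_prop) (integral_noise_energy hv a)]
  calc ∫ z, (‖a + z‖ ^ 2 - ‖a‖ ^ 2 - v) ^ 2 ∂complexGaussian v
      ≤ ∫ z, (8 * ‖a‖ ^ 2 * ‖z‖ ^ 2 + 2 * (‖z‖ ^ 2 - v) ^ 2) ∂complexGaussian v := by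
        refine integral_mono (memLp_two_noise_energy v a).integrable_sq
          ((h2.const_mul _).add (hsq.const_mul 2)) fun z => ?_
        have hle : (starRingEnd ℂ a * z).re ^ 2 ≤ ‖a‖ ^ 2 * ‖z‖ ^ 2 := by
          have := Complex.abs_re_le_norm (starRingEnd ℂ a * z)
          rw [norm_mul, RCLike.norm_conj] at this
          rw [← mul_pow, ← sq_abs]
          gcongr
        have heq := norm_add_sq_eq a z
        simp only
        rw [show ‖a + z‖ ^ 2 - ‖a‖ ^ 2 - v = 2 * (starRingEnd ℂ a * z).re + (‖z‖ ^ 2 - v) by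
          rw [heq]; ring]
        nlinarith [sq_nonneg (2 * (starRingEnd ℂ a * z).re - (‖z‖ ^ 2 - v))]
    _ ≤ _ := by
        rw [integral_add (h2.const_mul _) (hsq.const_mul 2), integral_const_mul,
          integral_const_mul, integral_norm_sq_complexGaussian hv]
        linarith

/-- Given the signal, the energies of distinct samples are independent, so that the squared
deviation of the total energy from its mean is the sum of the variances. -/
lemma lintegral_sq_energy_le {ι : Type*} [Fintype ι] {v : ℝ} (hv : 0 ≤ v) (a : ι → ℂ) :
    ∫⁻ z, ENNReal.ofReal ((∑ i, (‖a i + z i‖ ^ 2 - ‖a i‖ ^ 2 - v)) ^ 2)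
        ∂(Measure.pi fun _ : ι => complexGaussian v) ≤
      ENNReal.ofReal (∑ i, (8 * ‖a i‖ ^ 2 * v +
        2 * v ^ 2 * ∫ z, ‖z‖ ^ 4 ∂complexGaussian 1)) := by
  have hi : ∀ i, MemLp (fun z : ι → ℂ => ‖a i + z i‖ ^ 2 - ‖a i‖ ^ 2 - v) 2
      (Measure.pi fun _ : ι => complexGaussian v) := fun i =>
    (memLp_two_noise_energy v (a i)).comp_measurePreserving
      (measurePreserving_eval (fun _ : ι => complexGaussian v) i)
  have hmem : MemLp (fun z : ι → ℂ => ∑ i, (‖a i + z i‖ ^ 2 - ‖a i‖ ^ 2 - v)) 2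
      (Measure.pi fun _ : ι => complexGaussian v) := memLp_finsetSum _ fun i _ => hi i
  have h0 : ∫ z, ∑ i, (‖a i + z i‖ ^ 2 - ‖a i‖ ^ 2 - v)
      ∂(Measure.pi fun _ : ι => complexGaussian v) = 0 := by
    rw [integral_finsetSum _ fun i _ => (hi i).integrable (by norm_num)]
    refine Finset.sum_eq_zero fun i _ => ?_
    rw [integral_comp_eval (μ := fun _ : ι => complexGaussian v)
      (f := fun z : ℂ => ‖a i + z‖ ^ 2 - ‖a i‖ ^ 2 - v) (by fun_prop),
      integral_noise_energy hv]
  rw [← ofReal_integral_eq_lintegral_ofReal hmem.integrable_sq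
    (ae_of_all _ fun z => sq_nonneg _), ← variance_of_integral_eq_zero hmem.aemeasurable h0]
  refine ENNReal.ofReal_le_ofReal ?_
  have hvar := variance_sum_pi (μ := fun _ : ι => complexGaussian v)
    (X := fun i z => ‖a i + z‖ ^ 2 - ‖a i‖ ^ 2 - v) fun i => memLp_two_noise_energy v (a i)
  have hfun : (∑ i, fun z : ι → ℂ => ‖a i + z i‖ ^ 2 - ‖a i‖ ^ 2 - v) =
      fun z => ∑ i, (‖a i + z i‖ ^ 2 - ‖a i‖ ^ 2 - v) := by
    ext z
    simp
  rw [hfun] at hvar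
  rw [hvar]
  exact Finset.sum_le_sum fun i _ => variance_noise_energy_le hv (a i)

/-- The energy of the `L` samples in block `k`, normalized so that the signal contributes
`‖X k‖ ^ 2 / σN2`, minus the mean contribution `L` of the noise. -/
noncomputable def blockEnergy (σN2 : ℝ) (L : ℕ) (y : ℕ → ℂ) (k : ℕ) : ℝ :=
  L / σN2 * ∑ j : Fin L, ‖y (k * L + j)‖ ^ 2 - L

/-- The mean square error of the block energy as an estimate of the normalized input power. The
phases drop out, as only the modulus of the signal enters. -/
lemma lintegral_sq_blockEnergy_sub_le (β : ℝ) {σN2 snr : ℝ} (hσ : 0 < σN2) (hsnr : 0 < snr)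
    {L : ℕ} (hL : 0 < L) {input : Measure (ℕ → ℂ)} [IsProbabilityMeasure input]
    (h : HasShiftedExpAmplitudes (snr * σN2) input) (k : ℕ) :
    ∫⁻ ω, ENNReal.ofReal ((blockEnergy σN2 L (output L ω) k - ‖ω.1 k‖ ^ 2 / σN2) ^ 2)
        ∂channelLaw β σN2 L input ≤
      ENNReal.ofReal (8 * snr + 2 * L * ∫ z, ‖z‖ ^ 4 ∂complexGaussian 1) := by
  have hLr : (0 : ℝ) < L := by exact_mod_cast hL
  have hv : 0 < σN2 * (1 / L) := by positivity
  have hP : 0 < snr * σN2 := by positivity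
  have hinj : Function.Injective fun j : Fin L => k * L + (j : ℕ) := fun i j hij => by
    simpa [Fin.ext_iff] using hij
  have hmp := measurePreserving_decouple β σN2 L input hinj
  have hdiv : ∀ j : Fin L, (k * L + (j : ℕ)) / L = k := fun j => by
    rw [mul_comm, Nat.mul_add_div hL, Nat.div_eq_of_lt j.2, add_zero]
  set v := σN2 * (1 / (L : ℝ)) with hvdef
  set m := ∫ z, ‖z‖ ^ 4 ∂complexGaussian 1
  have hm : 0 ≤ m := integral_nonneg fun z => by positivity
  have hrw : ∀ ω : Sample, (blockEnergy σN2 L (output L ω) k - ‖ω.1 k‖ ^ 2 / σN2) ^ 2 =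
      (L / σN2) ^ 2 * (∑ j : Fin L, (‖signal L (decouple (fun j : Fin L => k * L + (j : ℕ)) ω).1
        (k * L + j) + (decouple (fun j : Fin L => k * L + (j : ℕ)) ω).2 j‖ ^ 2 -
        ‖signal L (decouple (fun j : Fin L => k * L + (j : ℕ)) ω).1 (k * L + j)‖ ^ 2 - v)) ^ 2 := by
    intro ω
    rw [← mul_pow]
    congr 1
    simp only [blockEnergy, ← output_eq_signal_add L (fun j : Fin L => k * L + (j : ℕ)) ω,
      Finset.sum_sub_distrib, norm_signal_sq, hdiv, Finset.sum_const, Finset.card_univ,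
      Fintype.card_fin, nsmul_eq_mul]
    simp only [decouple, hvdef]
    field_simp
    ring
  simp_rw [hrw]
  have hmeas : Measurable fun p : Transmission × (Fin L → ℂ) =>
      ENNReal.ofReal ((L / σN2) ^ 2 * (∑ j : Fin L, (‖signal L p.1 (k * L + j) + p.2 j‖ ^ 2 -
        ‖signal L p.1 (k * L + j)‖ ^ 2 - v)) ^ 2) := by
    have := fun j : Fin L => (measurable_signal L (k * L + j)).comp
      (measurable_fst : Measurable (Prod.fst : Transmission × (Fin L → ℂ) → Transmission))
    simp only [Function.comp_def] at this
    fun_prop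
  rw [hmp.lintegral_comp hmeas, lintegral_prod _ hmeas.aemeasurable]
  have hinner : ∀ t : Transmission, ∫⁻ z, ENNReal.ofReal ((L / σN2) ^ 2 *
      (∑ j : Fin L, (‖signal L t (k * L + j) + z j‖ ^ 2 - ‖signal L t (k * L + j)‖ ^ 2 - v)) ^ 2)
        ∂(Measure.pi fun _ : Fin L => complexGaussian v) ≤
      ENNReal.ofReal (8 / σN2 * ‖t.1 k‖ ^ 2 + 2 * L * m) := by
    intro t
    simp_rw [ENNReal.ofReal_mul (sq_nonneg ((L : ℝ) / σN2))]
    rw [lintegral_const_mul _ (by fun_prop)]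
    refine (mul_le_mul_right (lintegral_sq_energy_le hv.le
      fun j : Fin L => signal L t (k * L + j)) _).trans ?_
    rw [← ENNReal.ofReal_mul (by positivity)]
    refine ENNReal.ofReal_le_ofReal (le_of_eq ?_)
    simp only [norm_signal_sq, hdiv, Finset.sum_const, Finset.card_univ, Fintype.card_fin,
      nsmul_eq_mul]
    simp only [hvdef]
    field_simp
    rfl
  refine (lintegral_mono hinner).trans (le_of_eq ?_)
  have hi := (measurePreserving_transmission_input β L input).integrable_comp_of_integrable
    (h.integrable_norm_sq hP k)
  simp only [Function.comp_def] at hi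
  have hj : Integrable (fun t : Transmission => 8 / σN2 * ‖t.1 k‖ ^ 2 + 2 * L * m)
      (transmissionLaw β L input) := (hi.const_mul _).add (integrable_const _)
  rw [← ofReal_integral_eq_lintegral_ofReal hj
    (ae_of_all _ fun t => by positivity), integral_add (hi.const_mul _) (integrable_const _),
    integral_const_mul, integral_norm_sq_symbol hP h]
  congr 1
  simp
  field_simp

end EnergyVariance

/-! ### The lower bound on the information rate -/

section LowerBound

/-- The output density of the auxiliary Gaussian channel is at most the supremum `2 / P` of the
density of the input power: as a function of its mean, the Gaussian density has integral `1`. -/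
lemma lintegral_gaussianPDFReal_shiftedExp_le {snr σN2 : ℝ} (hsnr : 0 < snr) (hσ : 0 < σN2)
    {c : NNReal} (hc : c ≠ 0) (t : ℝ) :
    ∫⁻ u, ENNReal.ofReal (snr / 2 * gaussianPDFReal (u / σN2) c t) ∂shiftedExp (snr * σN2) ≤ 1 := by
  have hP : 0 < snr * σN2 := mul_pos hsnr hσ
  have hsymm : ∀ u, gaussianPDFReal (u / σN2) c t = gaussianPDFReal t c (σN2⁻¹ * u) := by
    intro u
    rw [show σN2⁻¹ * u = u / σN2 from inv_mul_eq_div _ _, gaussianPDFReal, gaussianPDFReal,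
      ← neg_sub t (u / σN2), neg_sq]
  have hdens : Measurable fun u : ℝ => ENNReal.ofReal (if snr * σN2 / 2 ≤ u then
      2 / (snr * σN2) * Real.exp (1 - 2 * u / (snr * σN2)) else 0) :=
    (Measurable.ite measurableSet_Ici (by fun_prop) measurable_const).ennreal_ofReal
  have hmeas : Measurable fun u => ENNReal.ofReal (snr / 2 * gaussianPDFReal (u / σN2) c t) := by
    simp_rw [hsymm]
    have := measurable_gaussianPDFReal t c
    fun_prop
  rw [shiftedExp, lintegral_withDensity_eq_lintegral_mul _ hdens hmeas]
  calc _ ≤ ∫⁻ u, ENNReal.ofReal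
        (gaussianPDFReal (σN2 * t) (NNReal.mk (σN2 ^ 2) (sq_nonneg _) * c) u) := by
        refine lintegral_mono fun u => ?_
        have hle : (if snr * σN2 / 2 ≤ u then
            2 / (snr * σN2) * Real.exp (1 - 2 * u / (snr * σN2)) else 0) ≤ 2 / (snr * σN2) := by
          split_ifs with hu
          · refine mul_le_of_le_one_right (by positivity) (Real.exp_le_one_iff.2 ?_)
            rw [sub_nonpos, le_div_iff₀ hP]
            linarith
          · positivity
        refine (mul_le_mul_left (ENNReal.ofReal_le_ofReal hle) _).trans (le_of_eq ?_)
        rw [← ENNReal.ofReal_mul (by positivity), hsymm, gaussianPDFReal_inv_mul hσ.ne',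
          abs_of_pos hσ]
        congr 1
        field_simp
    _ = 1 := lintegral_gaussianPDFReal_eq_one _
        (mul_ne_zero (fun h => (pow_pos hσ 2).ne' (congrArg NNReal.toReal h)) hc)

lemma blockIndex_lt {n L : ℕ} (k : Fin n) (j : Fin L) : (k : ℕ) * L + j < n * L :=
  calc (k : ℕ) * L + j < k * L + L := Nat.add_lt_add_left j.2 _
    _ = (k + 1) * L := by ring
    _ ≤ n * L := Nat.mul_le_mul_right L k.2

/-- Lower bound on the amplitude information by an auxiliary Gaussian channel of variance `c` from
the normalized input power to the normalized block energy. The test function is the product over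
the blocks of the ratio of this channel's density to the bound `2 / snr` on its output density. -/
lemma ofReal_le_amplitudeInfo (β : ℝ) {σN2 snr : ℝ} (hσ : 0 < σN2) (hsnr : 0 < snr)
    {L : ℕ} (hL : 0 < L) {input : Measure (ℕ → ℂ)} [IsProbabilityMeasure input]
    (h : HasShiftedExpAmplitudes (snr * σN2) input) {c : NNReal} (hc : c ≠ 0)
    (hcle : 8 * snr + 2 * L * ∫ z, ‖z‖ ^ 4 ∂complexGaussian 1 ≤ c) (n : ℕ) :
    ENNReal.ofReal (n * (Real.log (snr / 2) - 1 / 2 * Real.log (2 * Real.pi * c) - 1 / 2)) ≤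
      amplitudeInfo β σN2 L input n := by
  have hc0 : (0 : ℝ) < c := by positivity
  set μ := channelLaw β σN2 L input
  have hU : Measurable fun ω : Sample => fun k : Fin n => ‖ω.1 k‖ := by fun_prop
  have hV : Measurable fun ω : Sample => fun i : Fin (n * L) => output L ω i :=
    measurable_pi_iff.2 fun i => measurable_output L i
  have hUV := hU.prodMk hV
  have := Measure.isProbabilityMeasure_map (μ := μ) hU.aemeasurable
  have := Measure.isProbabilityMeasure_map (μ := μ) hV.aemeasurable
  have := Measure.isProbabilityMeasure_map (μ := μ) hUV.aemeasurable
  let T : (Fin (n * L) → ℂ) → Fin n → ℝ := fun y k =>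
    L / σN2 * ∑ j : Fin L, ‖y ⟨k * L + j, blockIndex_lt k j⟩‖ ^ 2 - L
  have hTω : ∀ ω k, T (fun i => output L ω i) k = blockEnergy σN2 L (output L ω) k :=
    fun ω k => rfl
  let φ : ℝ → ℝ → ℝ := fun r t => snr / 2 * gaussianPDFReal (r ^ 2 / σN2) c t
  have hφ : Measurable (Function.uncurry φ) := by
    have := measurable_uncurry_gaussianPDFReal
    have h2 : Measurable fun p : ℝ × ℝ => gaussianPDFReal (p.1 ^ 2 / σN2) c p.2 :=
      this.comp (by fun_prop : Measurable fun p : ℝ × ℝ => (p.1 ^ 2 / σN2, c, p.2))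
    exact h2.const_mul _
  have hφpos : ∀ r t, 0 < φ r t := fun r t =>
    mul_pos (half_pos hsnr) (gaussianPDFReal_pos _ _ _ hc)
  let g : (Fin n → ℝ) × (Fin (n * L) → ℂ) → ℝ≥0∞ := fun z =>
    ∏ k, ENNReal.ofReal (φ (z.1 k) (T z.2 k))
  have hg : Measurable g := Finset.measurable_prod _ fun k _ => (hφ.comp
    (by fun_prop : Measurable fun z : (Fin n → ℝ) × (Fin (n * L) → ℂ) =>
      (z.1 k, T z.2 k))).ennreal_ofReal
  have hfst : μ.map (fun ω : Sample => fun k : Fin n => ‖ω.1 k‖) =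
      input.map fun x => fun k : Fin n => ‖x k‖ := by
    rw [← (measurePreserving_channelLaw_input β σN2 L input).map_eq,
      Measure.map_map (by fun_prop) measurable_fst]
    rfl
  have hgν : ∫⁻ z, g z ∂((μ.map fun ω : Sample => fun k : Fin n => ‖ω.1 k‖).prod
      (μ.map fun ω : Sample => fun i : Fin (n * L) => output L ω i)) ≤ 1 := by
    rw [lintegral_prod_symm' _ hg]
    refine (lintegral_mono fun y => ?_).trans_eq
      (by simp : ∫⁻ _, 1 ∂(μ.map fun ω : Sample => fun i : Fin (n * L) => output L ω i) = 1)
    have hgy : Measurable fun r : Fin n → ℝ => g (r, y) := hg.comp measurable_prodMk_right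
    rw [hfst, lintegral_map hgy (by fun_prop)]
    have hm : ∀ k : Fin n, Measurable fun r => ENNReal.ofReal (φ r (T y k)) := fun k =>
      (hφ.comp (measurable_id.prodMk measurable_const)).ennreal_ofReal
    have hind := ((h.1.precomp (g := fun k : Fin n => (k : ℕ)) Fin.val_injective).comp
      (fun k r => ENNReal.ofReal (φ r (T y k))) hm)
    have hprod := lintegral_prod_eq_prod_lintegral_of_indepFun Finset.univ
      (fun (k : Fin n) (x : ℕ → ℂ) => ENNReal.ofReal (φ ‖x k‖ (T y k))) hind
      (fun k => (hm k).comp (by fun_prop))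
    simp only [g]
    rw [hprod]
    refine Finset.prod_le_one' fun k _ => ?_
    have hone := lintegral_gaussianPDFReal_shiftedExp_le hsnr hσ hc (T y k)
    have hm' : Measurable fun u : ℝ =>
        ENNReal.ofReal (snr / 2 * gaussianPDFReal (u / σN2) c (T y k)) := by
      have h2 : Measurable fun u : ℝ => gaussianPDFReal (u / σN2) c (T y k) :=
        measurable_uncurry_gaussianPDFReal.comp
          (by fun_prop : Measurable fun u : ℝ => (u / σN2, c, T y k))
      fun_prop
    rw [← h.2 k, lintegral_map hm' (by fun_prop)] at hone
    exact hone
  have hgpos : ∀ z, g z ≠ 0 := fun z =>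
    Finset.prod_ne_zero_iff.2 fun k _ => (ENNReal.ofReal_pos.2 (hφpos _ _)).ne'
  have hlogφ : ∀ r t, Real.log (φ r t) = Real.log (snr / 2) - 1 / 2 * Real.log (2 * Real.pi * c) -
      (t - r ^ 2 / σN2) ^ 2 / (2 * c) := by
    intro r t
    simp only [φ, gaussianPDFReal]
    rw [Real.log_mul (by positivity) (by positivity), Real.log_mul (by positivity) (by positivity),
      Real.log_exp, Real.log_inv, Real.log_sqrt (by positivity)]
    ring
  have hlog : ∀ z, Real.log (g z).toReal = ∑ k, (Real.log (snr / 2) -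
      1 / 2 * Real.log (2 * Real.pi * c) - (T z.2 k - z.1 k ^ 2 / σN2) ^ 2 / (2 * c)) := by
    intro z
    simp only [g]
    rw [ENNReal.toReal_prod, Real.log_prod fun k _ =>
      (ENNReal.toReal_pos (ENNReal.ofReal_pos.2 (hφpos _ _)).ne' ENNReal.ofReal_ne_top).ne']
    refine Finset.sum_congr rfl fun k _ => ?_
    rw [ENNReal.toReal_ofReal (hφpos _ _).le, hlogφ]
  -- Mean square error of the block energy as an estimate of the input power.
  have hem : ∀ k, Measurable fun ω : Sample =>
      (blockEnergy σN2 L (output L ω) k - ‖ω.1 k‖ ^ 2 / σN2) ^ 2 := by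
    intro k
    have := measurable_output L
    unfold blockEnergy
    fun_prop
  have herr : ∀ k, Integrable (fun ω : Sample =>
      (blockEnergy σN2 L (output L ω) k - ‖ω.1 k‖ ^ 2 / σN2) ^ 2) μ ∧
      ∫ ω, (blockEnergy σN2 L (output L ω) k - ‖ω.1 k‖ ^ 2 / σN2) ^ 2 ∂μ ≤ c := by
    intro k
    have hle := (lintegral_sq_blockEnergy_sub_le β hσ hsnr hL h k).trans
      (ENNReal.ofReal_le_ofReal hcle)
    have hi : Integrable (fun ω : Sample =>
        (blockEnergy σN2 L (output L ω) k - ‖ω.1 k‖ ^ 2 / σN2) ^ 2) μ := by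
      refine ⟨(hem k).aestronglyMeasurable, ?_⟩
      rw [hasFiniteIntegral_iff_ofReal (ae_of_all _ fun ω => sq_nonneg _)]
      exact hle.trans_lt ENNReal.ofReal_lt_top
    refine ⟨hi, ?_⟩
    rw [← ofReal_integral_eq_lintegral_ofReal hi (ae_of_all _ fun ω => sq_nonneg _)] at hle
    exact (ENNReal.ofReal_le_ofReal_iff hc0.le).1 hle
  have hterm : ∀ k : Fin n, Integrable (fun ω : Sample => Real.log (snr / 2) -
      1 / 2 * Real.log (2 * Real.pi * c) -
      (blockEnergy σN2 L (output L ω) k - ‖ω.1 k‖ ^ 2 / σN2) ^ 2 / (2 * c)) μ := fun k =>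
    (integrable_const _).sub ((herr k).1.div_const _)
  have hlm : Measurable fun z => Real.log (g z).toReal := by fun_prop
  have main := ofReal_integral_log_le_klDiv
    (μ := μ.map fun ω : Sample => ((fun k : Fin n => ‖ω.1 k‖),
      fun i : Fin (n * L) => output L ω i)) hg hgν (ae_of_all _ hgpos)
    ((integrable_map_measure hlm.aestronglyMeasurable hUV.aemeasurable).2 (by
      simp only [Function.comp_def, hlog, hTω]
      exact integrable_finsetSum _ fun k _ => hterm k))
  refine le_trans (ENNReal.ofReal_le_ofReal ?_) main
  rw [integral_map hUV.aemeasurable hlm.aestronglyMeasurable]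
  simp only [hlog, hTω]
  rw [integral_finsetSum _ fun k _ => hterm k]
  have hk : ∀ k : Fin n, Real.log (snr / 2) - 1 / 2 * Real.log (2 * Real.pi * c) - 1 / 2 ≤
      ∫ ω, (Real.log (snr / 2) - 1 / 2 * Real.log (2 * Real.pi * c) -
        (blockEnergy σN2 L (output L ω) k - ‖ω.1 k‖ ^ 2 / σN2) ^ 2 / (2 * c)) ∂μ := by
    intro k
    rw [integral_sub (integrable_const _) ((herr k).1.div_const _), integral_div]
    have : (∫ ω, (blockEnergy σN2 L (output L ω) k - ‖ω.1 k‖ ^ 2 / σN2) ^ 2 ∂μ) / (2 * c) ≤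
        1 / 2 := by
      rw [div_le_iff₀ (by positivity)]
      linarith [(herr k).2]
    simp
    simp at this
    linarith
  have hsum := Finset.sum_le_sum fun k (_ : k ∈ (Finset.univ : Finset (Fin n))) => hk k
  rw [Finset.sum_const, Finset.card_univ, Fintype.card_fin, nsmul_eq_mul] at hsum
  exact hsum

/-- A uniform lower bound on the information of the blocks bounds the information rate. -/
lemma ofReal_le_amplitudeRate {β σN2 b : ℝ} {L : ℕ} {input : Measure (ℕ → ℂ)}
    (h : ∀ n : ℕ, ENNReal.ofReal (n * b) ≤ amplitudeInfo β σN2 L input n) :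
    ENNReal.ofReal b ≤ amplitudeRate β σN2 L input := by
  refine le_liminf_of_le (by isBoundedDefault) ?_
  filter_upwards [eventually_gt_atTop 0] with n hn
  rw [ENNReal.le_div_iff_mul_le (Or.inl (by simpa using hn.ne')) (Or.inl (by simp)), mul_comm,
    ← ENNReal.ofReal_natCast, ← ENNReal.ofReal_mul (by positivity)]
  exact h n

/-- The oversampling factor is of smaller order than the signal-to-noise ratio, so that the
contribution of the noise energy to the variance of the block energy is negligible. -/
lemma eventually_mul_samplesPerSymbol_le {β : ℝ} (hβ : 0 < β) (m : ℝ) (hm : 0 ≤ m) :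
    ∀ᶠ snr in atTop, 2 * (samplesPerSymbol β snr : ℝ) * m ≤ 8 * snr := by
  have hs := Real.tendsto_sqrt_atTop.eventually_ge_atTop ((β + 1) * m)
  filter_upwards [hs, eventually_ge_atTop 1] with snr h1 h2
  have hsq : √snr * √snr = snr := Real.mul_self_sqrt (by linarith)
  have hs1 : 1 ≤ √snr := Real.one_le_sqrt.2 h2
  have hL : (samplesPerSymbol β snr : ℝ) ≤ β * √snr + 1 :=
    (Nat.ceil_lt_add_one (by positivity)).le
  have hL' : (samplesPerSymbol β snr : ℝ) ≤ (β + 1) * √snr := by nlinarith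
  calc 2 * (samplesPerSymbol β snr : ℝ) * m ≤ 2 * ((β + 1) * √snr) * m := by gcongr
    _ = 2 * (√snr * ((β + 1) * m)) := by ring
    _ ≤ 2 * (√snr * √snr) := by gcongr
    _ ≤ 8 * snr := by rw [hsq]; linarith

lemma samplesPerSymbol_pos {β snr : ℝ} (hβ : 0 < β) (hsnr : 0 < snr) :
    0 < samplesPerSymbol β snr :=
  Nat.ceil_pos.2 (mul_pos hβ (Real.sqrt_pos.2 hsnr))

/-- The constant obtained from an auxiliary channel of variance `16 * snr` exceeds the one claimed,
because `2 * log 2 < 3 / 2`. -/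
lemma auxiliary_channel_bound_ge {snr : ℝ} (hsnr : 0 < snr) :
    -2 - 1 / 2 * Real.log (8 * Real.pi) + 1 / 2 * Real.log snr ≤
      Real.log (snr / 2) - 1 / 2 * Real.log (2 * Real.pi * (16 * snr)) - 1 / 2 := by
  have h1 : Real.log (snr / 2) = Real.log snr - Real.log 2 :=
    Real.log_div hsnr.ne' two_ne_zero
  have h2 : Real.log (2 * Real.pi * (16 * snr)) =
      2 * Real.log 2 + Real.log (8 * Real.pi) + Real.log snr := by
    rw [show 2 * Real.pi * (16 * snr) = 2 ^ 2 * (8 * Real.pi) * snr by ring,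
      Real.log_mul (by positivity) hsnr.ne', Real.log_mul (by positivity) (by positivity),
      Real.log_pow]
    norm_num
  have := Real.log_two_lt_d9
  rw [h1, h2]
  linarith

end LowerBound

end WienerPhaseNoise

open WienerPhaseNoise in
theorem mainTheorem4 (β : ℝ) (hβ : 0 < β)
    (σN2 : ℝ → ℝ) (hσ : ∀ snr : ℝ, 0 < snr → 0 < σN2 snr)
    (input : ℝ → Measure (ℕ → ℂ))
    (hprob : ∀ snr : ℝ, 0 < snr → IsProbabilityMeasure (input snr))
    (hamp : ∀ snr : ℝ, 0 < snr → HasShiftedExpAmplitudes (snr * σN2 snr) (input snr)) :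
    (∀ snr : ℝ, 0 < snr → IsIID (input snr) →
      amplitudeRate β (σN2 snr) (samplesPerSymbol β snr) (input snr) ≠ ∞ ∧
      Tendsto (fun n : ℕ =>
          amplitudeInfo β (σN2 snr) (samplesPerSymbol β snr) (input snr) n / n) atTop
        (𝓝 (amplitudeRate β (σN2 snr) (samplesPerSymbol β snr) (input snr)))) ∧
    ((-2 - 1 / 2 * Real.log (8 * Real.pi) : ℝ) : EReal) ≤
      liminf (fun snr : ℝ =>
        ((amplitudeRate β (σN2 snr) (samplesPerSymbol β snr) (input snr) : ℝ≥0∞) : EReal)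
          - ((1 / 2 * Real.log snr : ℝ) : EReal)) atTop := by
  refine ⟨fun snr hsnr hiid => ?_, ?_⟩
  · have := hprob snr hsnr
    exact amplitudeRate_ne_top_and_tendsto β (hσ snr hsnr) (mul_pos hsnr (hσ snr hsnr))
      (samplesPerSymbol_pos hβ hsnr) (hamp snr hsnr) hiid
  refine le_liminf_of_le (by isBoundedDefault) ?_
  -- The auxiliary channel has variance `16 * snr`, of which the term linear in `L` takes at most
  -- one half.
  filter_upwards [eventually_mul_samplesPerSymbol_le hβ (∫ z, ‖z‖ ^ 4 ∂complexGaussian 1)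
    (integral_nonneg fun z => by positivity), eventually_gt_atTop 0] with snr hle hsnr
  have := hprob snr hsnr
  have hrate := ofReal_le_amplitudeRate (ofReal_le_amplitudeInfo β (hσ snr hsnr) hsnr
    (samplesPerSymbol_pos hβ hsnr) (hamp snr hsnr) (c := (16 * snr).toNNReal)
    (by simpa using hsnr) (by rw [Real.coe_toNNReal _ (by positivity)]; linarith))
  rw [Real.coe_toNNReal _ (by positivity)] at hrate
  have hb := auxiliary_channel_bound_ge hsnr
  rw [EReal.le_sub_iff_add_le (Or.inl (EReal.coe_ne_bot _)) (Or.inl (EReal.coe_ne_top _)),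
    ← EReal.coe_add]
  refine (EReal.coe_le_coe_iff.2 hb).trans (le_trans ?_
    (EReal.coe_ennreal_le_coe_ennreal_iff.2 hrate))
  rw [EReal.coe_ennreal_ofReal]
  exact EReal.coe_le_coe_iff.2 (le_max_left _ _)
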